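/- **Setting.** Let $\mathcal D$ be a probability distribution on $\mathcal X\times\{+1,-1\}$ with marginal $\mathcal D_{\mathcal X}$ and $\eta(x)=\mathbb P(y=+1\mid x)$. Let $\mathcal F$ be a class of measurable functions $\mathcal X\to[0,1]$ such that $\eta=f^\star$ ($\mathcal D_{\mathcal X}$-almost everywhere) for some $f^\star\in\mathcal F$ (realizability). Assume the following regularity: some countable $\mathcal F_0\subseteq\mathcal F$ is such that every $f\in\mathcal F$ is a pointwise limit of a sequence in $\mathcal F_0$; the minima over $\mathcal F$ in step 1 below are attained, and a regression oracle returns a minimizer; and the confidence bounds $\mathsf{lcb},\mathsf{ucb}$ below are jointly measurable in the sample and in $x$. For $\gamma\in(0,\frac12)$, Chow's error of $\hat h:\mathcal X\to\{+1,-1,\bot\}$ is $\mathrm{err}_\gamma(\hat h)=\mathbb P(\hat h(x)\ne y,\ \hat h(x)\neq\bot)+(\frac12-\gamma)\,\mathbb P(\hat h(x)=\bot)$. Its Chow's excess error is $\mathrm{err}_\gamma(\hat h)-\mathbb P(h^\star(x)\ne y)$, where $h^\star=\operatorname{sgn}(2f^\star-1)$ (with $\operatorname{sgn}(0)=+1$).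 Let $d=\mathrm{Pdim}(\mathcal F)$ be the VC dimension of the family of sets $\{(x,\zeta)\in\mathcal X\times\mathbb R: f(x)>\zeta\}$, $f\in\mathcal F$, and assume $1\le d<\infty$. For $f_0\in\mathcal F$ and $\gamma_0,\epsilon_0>0$ let $$\theta^{\mathrm{val}}_{f_0}(\mathcal F,\gamma_0,\epsilon_0)=\sup_{\mu}\sup_{\gamma'>\gamma_0,\ \epsilon'>\epsilon_0}\Big\{\tfrac{\gamma'^2}{\epsilon'^2}\,\mu\big(\{x:\exists f\in\mathcal F:\ |f(x)-f_0(x)|>\gamma',\ \|f-f_0\|_{L^2(\mu)}\le\epsilon'\}\big)\Big\}\vee 1,$$ where $\mu$ ranges over all probability distributions on $\mathcal X$ (outer measure if the set is not measurable). Let $\theta=\sup_{f_0\in\mathcal F,\ \iota>0}\theta^{\mathrm{val}}_{f_0}(\mathcal F,\gamma/2,\iota)$ and assume $\theta<\infty$. **Algorithm.** Input: $\epsilon\in(0,1]$, $\gamma\in(0,\frac12)$, $\delta\in(0,1)$, the class $\mathcal F$ with its regression oracle, and the numbers $d$, $\theta$. For constants $c_T,c_C>0$ put $$T=c_T\,\frac{\theta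 d}{\epsilon\gamma}\log\frac{\theta d}{\epsilon\gamma\delta},\quad M=\lceil\log_2T\rceil,\quad C_\delta=c_C\, d\log\frac T\delta,\quad \tau_0=0,\ \ \tau_m=2^m\ (m\ge1),\quad \beta_m=(M-m+1)\,C_\delta .$$ Examples $(x_t,y_t)$, $t\ge1$, are drawn independently from $\mathcal D$; the algorithm sees $x_t$, and sees $y_t$ only if it queries it ($Q_t=1$). In epoch $m=1,\dots,M$: 1. Let $\hat R_m(f)=\sum_{t\le\tau_{m-1}}Q_t\,(f(x_t)-\mathbb 1\{y_t=+1\})^2$, let $\hat f_m\in\arg\min_{f\in\mathcal F}\hat R_m(f)$, and let $\mathcal F_m=\{f\in\mathcal F:\hat R_m(f)\le\hat R_m(\hat f_m)+\beta_m\}$. 2. Let $\mathsf{lcb}_m(x)=\inf_{f\in\mathcal F_m}f(x)$ and $\mathsf{ucb}_m(x)=\sup_{f\in\mathcal F_m}f(x)$. Put $\hat h_m(x)=\bot$ if $[\mathsf{lcb}_m(x),\mathsf{ucb}_m(x)]\subseteq[\frac12-\gamma,\frac12+\gamma]$, and $\hat h_m(x)=\operatorname{sgn}(2\hat f_m(x)-1)$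 otherwise; here, at a tie $\hat f_m(x)=\frac12$, the sign is $-1$ if $\mathsf{ucb}_m(x)\le\frac12$ and $+1$ otherwise. Put $g_m(x)=1$ if $\frac12\in(\mathsf{lcb}_m(x),\mathsf{ucb}_m(x))$ and $\hat h_m(x)\ne\bot$, and $g_m(x)=0$ otherwise. 3. If $m=M$, return $\hat h_M$. Otherwise, for $t=\tau_{m-1}+1,\dots,\tau_m$, observe $x_t$, set $Q_t=g_m(x_t)$, and query $y_t$ if $Q_t=1$. **Theorem.** There are universal constants $c_T,c_C,c_L>0$ such that, in every setting as above and for all $\epsilon\in(0,1]$, $\gamma\in(0,\frac12)$, $\delta\in(0,1)$, with probability at least $1-2\delta$ the algorithm with the constants $c_T,c_C$ returns a classifier $\hat h_M$ whose Chow's excess error is at most $\epsilon$, and the number of labels that it queries is at most $$c_L\cdot\frac{\theta\, d}{\gamma^2}\cdot\log^2\!\Big(\frac{\theta\, d}{\epsilon\gamma}\Big)\cdot\log\!\Big(\frac{\theta\, d}{\epsilon\gamma\delta}\Big).$$ -/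

import Mathlib

open MeasureTheory ProbabilityTheory Filter Topology
open scoped ENNReal

namespace AbstainAL

noncomputable section

/-! ### Complexity of a class of regression functions -/

/-- The family `C` of subsets of `α` shatters the finite set `s`. -/
def Shatters {α : Type*} (C : Set (Set α)) (s : Finset α) : Prop :=
  ∀ t : Finset α, t ⊆ s → ∃ c ∈ C, (s : Set α) ∩ c = t

/-- The VC dimension: the supremum of the sizes of the finite shattered sets. -/
def vcDim {α : Type*} (C : Set (Set α)) : ℕ∞ :=
  ⨆ (s : Finset α) (_ : Shatters C s), (s.card : ℕ∞)

/-- The pseudo dimension: the VC dimension of the family of threshold sets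
`{(x, ζ) | f x > ζ}`, `f ∈ F`. -/
def pdim {X : Type*} (F : Set (X → ℝ)) : ℕ∞ :=
  vcDim ((fun f : X → ℝ => {p : X × ℝ | p.2 < f p.1}) '' F)

/-- The norm of `f` in `L²(μ)`. -/
def l2norm {X : Type*} [MeasurableSpace X] (μ : Measure X) (f : X → ℝ) : ℝ :=
  Real.sqrt (∫ x, f x ^ 2 ∂μ)

/-- The value function disagreement coefficient of `F` at `fstar`, for the scales `γ₀`, `ε₀`;
the outer supremum is over all probability distributions on the input space. -/
def valDisagreement {X : Type*} [MeasurableSpace X] (F : Set (X → ℝ)) (fstar : X → ℝ)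
    (γ₀ ε₀ : ℝ) : ℝ≥0∞ :=
  (⨆ (μ : Measure X) (_ : IsProbabilityMeasure μ) (γ : ℝ) (_ : γ₀ < γ) (ε : ℝ) (_ : ε₀ < ε),
    ENNReal.ofReal (γ ^ 2 / ε ^ 2) *
      μ {x | ∃ f ∈ F, γ < |f x - fstar x| ∧ l2norm μ (fun x' => f x' - fstar x') ≤ ε}) ⊔ 1

/-- `θ = sup_{fstar ∈ F, ι > 0}` of the disagreement coefficient at the scales `γ / 2` and `ι`. -/
def theta {X : Type*} [MeasurableSpace X] (F : Set (X → ℝ)) (γ : ℝ) : ℝ≥0∞ :=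
  ⨆ (fstar : X → ℝ) (_ : fstar ∈ F) (ι : ℝ) (_ : 0 < ι), valDisagreement F fstar (γ / 2) ι

/-- Pointwise separability: some countable subclass of `F` approximates every member of `F`
along a pointwise convergent sequence. -/
def PointwiseSeparable {X : Type*} (F : Set (X → ℝ)) : Prop :=
  ∃ F₀ : Set (X → ℝ), F₀ ⊆ F ∧ F₀.Countable ∧
    ∀ f ∈ F, ∃ u : ℕ → X → ℝ, (∀ n, u n ∈ F₀) ∧
      ∀ x, Tendsto (fun n => u n x) atTop (𝓝 (f x))

/-! ### Errors

The label `+1` is encoded as `true` and the label `-1` as `false`; a classifier that may abstain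
takes its values in `Option Bool`, with `none` for abstention. -/

/-- The classifier `h_f = sign (2 f - 1)` induced by a regression function. -/
def inducedClassifier {X : Type*} (f : X → ℝ) (x : X) : Bool :=
  decide (1 / 2 ≤ f x)

/-- The standard error of a classifier. -/
def err {X : Type*} [MeasurableSpace X] (D : Measure (X × Bool)) (h : X → Bool) : ℝ :=
  D.real {z | h z.1 ≠ z.2}

/-- Chow's error of an abstaining classifier. -/
def chowErr {X : Type*} [MeasurableSpace X] (D : Measure (X × Bool)) (γ : ℝ)
    (h : X → Option Bool) : ℝ :=
  D.real {z | h z.1 ≠ some z.2 ∧ h z.1 ≠ none} + (1 / 2 - γ) * D.real {z | h z.1 = none}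

/-- Chow's excess error, relative to the Bayes classifier `h_{fstar}`. -/
def chowExcess {X : Type*} [MeasurableSpace X] (D : Measure (X × Bool)) (γ : ℝ)
    (fstar : X → ℝ) (h : X → Option Bool) : ℝ :=
  chowErr D γ h - err D (inducedClassifier fstar)

/-- Realizability: `fstar` is the conditional probability of the label `+1` given `x`. -/
def Realizes {X : Type*} [MeasurableSpace X] (D : Measure (X × Bool)) [IsFiniteMeasure D]
    (fstar : X → ℝ) : Prop :=
  ∀ᵐ x ∂D.fst, (D.condKernel x).real {true} = fstar x

/-! ### The algorithm -/

/-- The numerical value of a label in the square loss, where `f x` predicts the probability of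
the label `+1`. -/
def labelVal (y : Bool) : ℝ := if y then 1 else 0

/-- The cumulative square loss of `f` on a list of labelled examples. -/
def sqLoss {X : Type*} (f : X → ℝ) (S : List (X × Bool)) : ℝ :=
  (S.map fun z => (f z.1 - labelVal z.2) ^ 2).sum

/-- A regression oracle returns a minimizer over `F` of the cumulative square loss. -/
def IsRegressionOracle {X : Type*} (F : Set (X → ℝ)) (oracle : List (X × Bool) → X → ℝ) : Prop :=
  ∀ S, oracle S ∈ F ∧ ∀ f ∈ F, sqLoss (oracle S) S ≤ sqLoss f S

/-- The active set of regression functions: those whose loss on the queried examples `S` exceeds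
the least loss by at most `β`. -/
def activeSet {X : Type*} (F : Set (X → ℝ)) (oracle : List (X × Bool) → X → ℝ)
    (S : List (X × Bool)) (β : ℝ) : Set (X → ℝ) :=
  {f | f ∈ F ∧ sqLoss f S ≤ sqLoss (oracle S) S + β}

def lcb {X : Type*} (G : Set (X → ℝ)) (x : X) : ℝ := sInf ((fun f : X → ℝ => f x) '' G)

def ucb {X : Type*} (G : Set (X → ℝ)) (x : X) : ℝ := sSup ((fun f : X → ℝ => f x) '' G)

open scoped Classical in
/-- The classifier of an epoch with active set `G` and empirical minimizer `fhat`: it abstains where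
`[lcb, ucb] ⊆ [1/2 - γ, 1/2 + γ]` and predicts `sign (2 fhat - 1)` elsewhere. At a tie
`fhat x = 1/2` the sign is read off the confidence interval: `-1` if `ucb ≤ 1/2`, else `+1`. -/
def epochClassifier {X : Type*} (G : Set (X → ℝ)) (fhat : X → ℝ) (γ : ℝ) (x : X) : Option Bool :=
  if Set.Icc (lcb G x) (ucb G x) ⊆ Set.Icc (1 / 2 - γ) (1 / 2 + γ) then none
  else if 1 / 2 < fhat x then some true
  else if fhat x < 1 / 2 then some false
  else if ucb G x ≤ 1 / 2 then some false
  else some true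

/-- The query rule `g_m(x) = 1` of an epoch with active set `G` and empirical minimizer `fhat`. -/
def Queries {X : Type*} (G : Set (X → ℝ)) (fhat : X → ℝ) (γ : ℝ) (x : X) : Prop :=
  1 / 2 ∈ Set.Ioo (lcb G x) (ucb G x) ∧ epochClassifier G fhat γ x ≠ none

/-- The epoch boundaries `τ_0 = 0` and `τ_m = 2 ^ m`. -/
def tau : ℕ → ℕ
  | 0 => 0
  | m + 1 => 2 ^ (m + 1)

/-- The elimination thresholds `β_m = (M - m + 1) * C`. -/
def beta (M : ℕ) (C : ℝ) (m : ℕ) : ℝ := ((M : ℝ) - (m : ℝ) + 1) * C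

open scoped Classical in
/-- The queried examples, with their labels, at the end of epoch `m`, when the algorithm
is run on the stream `z 1, z 2, …` of examples `z t = (x_t, y_t)`. In epoch `m + 1` the times
`t = τ_m + 1, …, τ_{m+1}` are processed; the decision to query looks only at `x_t` and at the
examples queried in earlier epochs, and `y_t` is recorded only if it is queried. -/
def queried {X : Type*} (F : Set (X → ℝ)) (oracle : List (X × Bool) → X → ℝ) (γ : ℝ) (M : ℕ)
    (C : ℝ) (z : ℕ → X × Bool) : ℕ → List (X × Bool)
  | 0 => []
  | m + 1 =>
    let S := queried F oracle γ M C z m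
    S ++ ((List.range' (tau m + 1) (tau (m + 1) - tau m)).map z).filter
      fun w => decide (Queries (activeSet F oracle S (beta M C (m + 1))) (oracle S) γ w.1)

/-- The classifier returned in epoch `M`; the labels were queried in the epochs `1, …, M - 1`. -/
def output {X : Type*} (F : Set (X → ℝ)) (oracle : List (X × Bool) → X → ℝ) (γ : ℝ) (M : ℕ)
    (C : ℝ) (z : ℕ → X × Bool) : X → Option Bool :=
  let S := queried F oracle γ M C z (M - 1)
  epochClassifier (activeSet F oracle S (beta M C M)) (oracle S) γ

/-- The number of labels queried in a run of the algorithm. -/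
def labelCount {X : Type*} (F : Set (X → ℝ)) (oracle : List (X × Bool) → X → ℝ) (γ : ℝ) (M : ℕ)
    (C : ℝ) (z : ℕ → X × Bool) : ℕ :=
  (queried F oracle γ M C z (M - 1)).length

end

end AbstainAL

namespace AbstainAL

/-! ### Traces of a class of finite pseudo dimension -/

/-! The argument is deterministic on a good event of probability at least `1 - 2 * δ`. On that event
(`exists_good_event`), for every `f ∈ F` and every window of times, the excess squared loss of `f`
over `fstar` on the queried labels is at least a quarter of the summed squared distances of `f` to
`fstar` on the query regions, minus `C / 2` (`GoodLoss`). Moreover, the number of queries in the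
last `J` epochs is at most twice the sum of their conditional probabilities, plus `C`.

Concentration. For a single `f`, realizability bounds the conditional exponential moment of the
excess loss (`exp_loss_le`), so a supermartingale argument applies although the query regions depend
on the past. A union bound over `F` needs a finite net chosen independently of the sample.
Symmetrization and the Sauer-Shelah bound show that for some fixed ghost sample, on most true
samples, any two functions with the same discretized values on the ghost are close (`exists_net`).
One representative per pattern then suffices. This is done in the countable subclass, and pointwise
limits carry the bound to `F` (`measure_uniform_loss_le`).

Geometry of the run. `fstar` is never eliminated. The thresholds drop by `C` per epoch, which
absorbs two fluctuations of size `C / 2`, so the active sets and the query regions are nested. Hence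
an active `f` after `τ_m` samples has squared distance at most `8 (M - m) C / τ_m` to `fstar` on the
current region. Each queried point has an active function farther than `γ / 2` from `fstar`. The
disagreement coefficient, applied to the marginal conditioned on the region, bounds the mass of the
region by `32 θ (M - m) C / (γ² τ_m)` (`measureReal_le_theta`).

Excess error. Off the query region the prediction costs no more than the Bayes prediction, since
abstention occurs only where the Bayes error is at least `1/2 - γ`. On the region the cost is at
most `2 |f - fstar|`, which is split into squared distance and mass (`predLoss_le`,
`chowExcess_le`).

Labels. For `m ≥ 1`, epoch `m + 1` has length `τ_m`, so it contributes of order `θ (M - m) C / γ²`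
queries. Summing over all epochs would bring in powers of `M`, which depends on `δ`. Only the last
`J = ⌈log₂ (1 / ε)⌉` epochs are treated in this way; the earlier ones contain at most `ε T` times in
all, which is of order `(θ d / γ) log (A / δ)`. -/

lemma sum_choose_le_pow (N d : ℕ) : ∑ k ∈ Finset.Iic d, N.choose k ≤ (N + 1) ^ d := by
  rw [add_pow, Nat.range_succ_eq_Iic]
  refine Finset.sum_le_sum fun k hk => ?_
  rw [one_pow, mul_one]
  exact (Nat.choose_le_pow N k).trans
    (Nat.le_mul_of_pos_right _ (Nat.choose_pos (Finset.mem_Iic.1 hk)))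

open scoped Classical in
/-- The indices of the points of `X × ℝ` that lie strictly below the graph of `f`. -/
noncomputable def trace {X ι : Type*} [Fintype ι] (pts : ι → X × ℝ) (f : X → ℝ) : Finset ι :=
  Finset.univ.filter fun i => (pts i).2 < f (pts i).1

lemma mem_trace {X ι : Type*} [Fintype ι] {pts : ι → X × ℝ} {f : X → ℝ} {i : ι} :
    i ∈ trace pts f ↔ (pts i).2 < f (pts i).1 := by
  classical
  simp [trace]

/-- A shattering trace isolates each index of `s`, so `pts` is injective on `s`. The image of `s` is
then a set of the same size shattered by the threshold sets. -/
lemma card_le_of_shatters_trace {X ι : Type*} [Fintype ι] [DecidableEq ι] {F : Set (X → ℝ)} {d : ℕ}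
    (hd : pdim F ≤ d) (pts : ι → X × ℝ) {A : Finset (Finset ι)}
    (hA : ∀ t ∈ A, ∃ f ∈ F, trace pts f = t) {s : Finset ι} (hs : A.Shatters s) : s.card ≤ d := by
  classical
  have hinj : Set.InjOn pts s := by
    intro i hi j hj hij
    obtain ⟨u, hu, hiu⟩ := hs.exists_inter_eq_singleton hi
    obtain ⟨f, -, rfl⟩ := hA u hu
    have h1 : i ∈ s ∩ trace pts f := by rw [hiu]; simp
    have h2 : j ∈ s ∩ trace pts f := by
      rw [Finset.mem_inter, mem_trace, ← hij]
      exact ⟨hj, mem_trace.1 (Finset.mem_inter.1 h1).2⟩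
    rw [hiu] at h2
    exact (Finset.mem_singleton.1 h2).symm
  have hsh : Shatters ((fun f : X → ℝ => {p : X × ℝ | p.2 < f p.1}) '' F) (s.image pts) := by
    intro t ht
    obtain ⟨u, hu, hsu⟩ := hs (t := s.filter fun i => pts i ∈ t) (Finset.filter_subset _ _)
    obtain ⟨f, hf, rfl⟩ := hA u hu
    refine ⟨_, ⟨f, hf, rfl⟩, ?_⟩
    ext p
    simp only [Finset.coe_image, Set.mem_inter_iff, Set.mem_image, Finset.mem_coe,
      Set.mem_ofPred_eq]
    constructor
    · rintro ⟨⟨i, hi, rfl⟩, hp⟩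
      have : i ∈ s ∩ trace pts f := Finset.mem_inter.2 ⟨hi, mem_trace.2 hp⟩
      rw [hsu] at this
      exact (Finset.mem_filter.1 this).2
    · intro hp
      obtain ⟨i, hi, rfl⟩ := Finset.mem_image.1 (ht hp)
      have : i ∈ s ∩ trace pts f := by rw [hsu]; exact Finset.mem_filter.2 ⟨hi, hp⟩
      exact ⟨⟨i, hi, rfl⟩, mem_trace.1 (Finset.mem_inter.1 this).2⟩
  have h := (le_iSup₂ (f := fun (s : Finset (X × ℝ))
    (_ : Shatters ((fun f : X → ℝ => {p : X × ℝ | p.2 < f p.1}) '' F) s) => (s.card : ℕ∞))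
    _ hsh).trans hd
  rw [Finset.card_image_of_injOn hinj] at h
  exact_mod_cast h

/-- The Sauer-Shelah bound for the traces of a class of functions. -/
lemma card_traces_le {X ι : Type*} [Fintype ι] {F : Set (X → ℝ)} {d : ℕ} (hd : pdim F ≤ d)
    (pts : ι → X × ℝ) {A : Finset (Finset ι)} (hA : ∀ t ∈ A, ∃ f ∈ F, trace pts f = t) :
    A.card ≤ (Fintype.card ι + 1) ^ d := by
  classical
  calc A.card ≤ A.shatterer.card := Finset.card_le_card_shatterer A
    _ ≤ ∑ k ∈ Finset.Iic A.vcDim, (Fintype.card ι).choose k := Finset.card_shatterer_le_sum_vcDim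
    _ ≤ ∑ k ∈ Finset.Iic d, (Fintype.card ι).choose k := by
        refine Finset.sum_le_sum_of_subset (Finset.Iic_subset_Iic.2 (Finset.sup_le fun s hs => ?_))
        exact card_le_of_shatters_trace hd pts hA (Finset.mem_shatterer.1 hs)
    _ ≤ _ := sum_choose_le_pow _ _

lemma pdim_mono {X : Type*} {F G : Set (X → ℝ)} (h : F ⊆ G) : pdim F ≤ pdim G := by
  refine iSup₂_le fun s hs => le_iSup₂_of_le s (fun t ht => ?_) le_rfl
  obtain ⟨c, hc, e⟩ := hs t ht
  exact ⟨c, Set.image_mono h hc, e⟩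

/-! ### Counting swaps -/

open scoped Classical in
-- At an index where the two patterns differ on some side, agreement on the chosen side determines
-- `σ i`. Only the other indices are free, and at least `L` indices are of the first kind.
lemma card_swaps_pair_le {n : ℕ} {β : Type*} (p q : Fin n → Bool → β) (L : ℕ) :
    (Finset.univ.filter fun σ : Fin n → Bool => (∀ i, p i (σ i) = q i (σ i)) ∧
      L ≤ (Finset.univ.filter fun i => p i (!σ i) ≠ q i (!σ i)).card).card * 2 ^ L ≤ 2 ^ n := by
  set B := Finset.univ.filter fun σ : Fin n → Bool => (∀ i, p i (σ i) = q i (σ i)) ∧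
      L ≤ (Finset.univ.filter fun i => p i (!σ i) ≠ q i (!σ i)).card with hB
  set E := Finset.univ.filter fun i : Fin n => ∃ b, p i b ≠ q i b with hE
  rcases B.eq_empty_or_nonempty with h0 | ⟨σ₀, hσ₀⟩
  · simp [h0]
  have hL : L ≤ E.card := by
    refine (Finset.mem_filter.1 hσ₀).2.2.trans (Finset.card_le_card fun i hi => ?_)
    exact Finset.mem_filter.2 ⟨Finset.mem_univ _, _, (Finset.mem_filter.1 hi).2⟩
  have hcard : B.card ≤ 2 ^ (n - E.card) := by
    have hle : B.card ≤ Fintype.card ({i : Fin n // i ∈ Eᶜ} → Bool) := by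
      rw [← Finset.card_univ]
      refine Finset.card_le_card_of_injOn (fun σ i => σ i.1)
        (fun _ _ => Finset.mem_coe.2 (Finset.mem_univ _)) ?_
      intro σ hσ τ hτ hst
      funext i
      by_cases hi : i ∈ E
      · obtain ⟨b, hb⟩ := (Finset.mem_filter.1 hi).2
        have h1 := (Finset.mem_filter.1 (Finset.mem_coe.1 hσ)).2.1 i
        have h2 := (Finset.mem_filter.1 (Finset.mem_coe.1 hτ)).2.1 i
        have h1' : σ i ≠ b := fun h => hb (h ▸ h1)
        have h2' : τ i ≠ b := fun h => hb (h ▸ h2)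
        revert h1' h2'
        cases σ i <;> cases τ i <;> cases b <;> simp
      · exact congrFun hst ⟨i, Finset.mem_compl.2 hi⟩
    refine hle.trans_eq ?_
    rw [Fintype.card_fun, Fintype.card_bool, Fintype.card_coe, Finset.card_compl, Fintype.card_fin]
  have hEn : E.card ≤ n := (Finset.card_le_univ E).trans_eq (Fintype.card_fin n)
  calc B.card * 2 ^ L ≤ 2 ^ (n - E.card) * 2 ^ E.card :=
        Nat.mul_le_mul hcard (Nat.pow_le_pow_right (by norm_num) hL)
    _ = 2 ^ n := by rw [← pow_add, Nat.sub_add_cancel hEn]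

open scoped Classical in
lemma card_swaps_le {n : ℕ} {β : Type*} (A : Finset (Fin n → Bool → β)) (L : ℕ) :
    (Finset.univ.filter fun σ : Fin n → Bool => ∃ p ∈ A, ∃ q ∈ A, (∀ i, p i (σ i) = q i (σ i)) ∧
      L ≤ (Finset.univ.filter fun i => p i (!σ i) ≠ q i (!σ i)).card).card * 2 ^ L
      ≤ A.card ^ 2 * 2 ^ n := by
  have hsub : (Finset.univ.filter fun σ : Fin n → Bool => ∃ p ∈ A, ∃ q ∈ A,
      (∀ i, p i (σ i) = q i (σ i)) ∧
      L ≤ (Finset.univ.filter fun i => p i (!σ i) ≠ q i (!σ i)).card) ⊆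
      (A ×ˢ A).biUnion fun pq => Finset.univ.filter fun σ : Fin n → Bool =>
        (∀ i, pq.1 i (σ i) = pq.2 i (σ i)) ∧
        L ≤ (Finset.univ.filter fun i => pq.1 i (!σ i) ≠ pq.2 i (!σ i)).card := by
    intro σ hσ
    obtain ⟨p, hp, q, hq, h⟩ := (Finset.mem_filter.1 hσ).2
    exact Finset.mem_biUnion.2 ⟨(p, q), Finset.mem_product.2 ⟨hp, hq⟩,
      Finset.mem_filter.2 ⟨Finset.mem_univ _, h⟩⟩
  refine (Nat.mul_le_mul_right _ ((Finset.card_le_card hsub).trans Finset.card_biUnion_le)).trans ?_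
  rw [Finset.sum_mul]
  refine (Finset.sum_le_card_nsmul _ _ (2 ^ n)
    fun pq _ => card_swaps_pair_le pq.1 pq.2 L).trans_eq ?_
  rw [Finset.card_product, smul_eq_mul, sq]

/-! ### Discretization of the unit interval -/

open scoped Classical in
/-- The multiples of `1 / n` below `1` that are less than `v`. -/
noncomputable def cell (n : ℕ) (v : ℝ) : Finset (Fin n) :=
  Finset.univ.filter fun j => (j : ℝ) / n < v

lemma mem_cell {n : ℕ} {v : ℝ} {j : Fin n} : j ∈ cell n v ↔ (j : ℝ) / n < v := by
  classical
  simp [cell]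

lemma measurableSet_cell_eq {α : Type*} [MeasurableSpace α] (n : ℕ) {f g : α → ℝ}
    (hf : Measurable f) (hg : Measurable g) : MeasurableSet {x | cell n (f x) = cell n (g x)} := by
  have : {x | cell n (f x) = cell n (g x)} =
      ⋂ j : Fin n, {x | (j : ℝ) / n < f x ↔ (j : ℝ) / n < g x} := by
    ext x
    simp only [Set.mem_iInter, Set.mem_ofPred_eq, Finset.ext_iff, mem_cell]
  rw [this]
  refine MeasurableSet.iInter fun j => ?_
  exact (measurableSet_lt measurable_const hf).iff (measurableSet_lt measurable_const hg)

/-- Were the gap larger than `1 / n`, the grid point `⌈v * n⌉ / n` would lie in `[v, w)`. It is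
below `w ≤ 1`, so its index is in `Fin n`, and it separates the two cells. -/
lemma sub_le_of_cell_subset {n : ℕ} (hn : 0 < n) {v w : ℝ} (hv : 0 ≤ v) (hw : w ≤ 1)
    (h : cell n w ⊆ cell n v) : w - v ≤ 1 / n := by
  by_contra! hlt
  have hn' : (0 : ℝ) < n := by exact_mod_cast hn
  have h1 : v * n + 1 < w * n := by
    rw [div_lt_iff₀ hn'] at hlt
    linarith
  have h2 : ((⌈v * n⌉₊ : ℕ) : ℝ) < w * n := (Nat.ceil_lt_add_one (by positivity)).trans h1
  have h3 : ⌈v * n⌉₊ < n := by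
    have : ((⌈v * n⌉₊ : ℕ) : ℝ) < n := h2.trans_le (by nlinarith)
    exact_mod_cast this
  have h4 : (⟨⌈v * n⌉₊, h3⟩ : Fin n) ∈ cell n w := mem_cell.2 (by rwa [div_lt_iff₀ hn'])
  have h5 := mem_cell.1 (h h4)
  rw [div_lt_iff₀ hn'] at h5
  exact absurd (Nat.le_ceil (v * n)) (not_le.2 h5)

lemma abs_sub_le_of_cell_eq {n : ℕ} (hn : 0 < n) {v w : ℝ} (hv : v ∈ Set.Icc (0 : ℝ) 1)
    (hw : w ∈ Set.Icc (0 : ℝ) 1) (h : cell n v = cell n w) : |v - w| ≤ 1 / n :=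
  abs_sub_le_iff.2 ⟨sub_le_of_cell_subset hn hw.1 hv.2 h.subset,
    sub_le_of_cell_subset hn hv.1 hw.2 h.symm.subset⟩

open scoped Classical in
lemma sum_abs_sub_le_of_cell {n : ℕ} (hn : 0 < n) {v w : Fin n → ℝ}
    (hv : ∀ i, v i ∈ Set.Icc (0 : ℝ) 1) (hw : ∀ i, w i ∈ Set.Icc (0 : ℝ) 1) {L : ℕ}
    (h : (Finset.univ.filter fun i => cell n (v i) ≠ cell n (w i)).card < L) :
    ∑ i, |v i - w i| ≤ L + 1 := by
  have hn' : (0 : ℝ) < n := by exact_mod_cast hn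
  have h1 : ∀ i, |v i - w i| ≤ (if cell n (v i) ≠ cell n (w i) then 1 else 0) + 1 / n := by
    intro i
    split_ifs with hi
    · have : |v i - w i| ≤ 1 := abs_sub_le_iff.2
        ⟨by linarith [(hv i).2, (hw i).1], by linarith [(hw i).2, (hv i).1]⟩
      have : (0 : ℝ) ≤ 1 / n := by positivity
      linarith
    · rw [zero_add]
      exact abs_sub_le_of_cell_eq hn (hv i) (hw i) (not_not.1 hi)
  refine (Finset.sum_le_sum fun i _ => h1 i).trans ?_
  rw [Finset.sum_add_distrib, Finset.sum_boole, Finset.sum_const, Finset.card_univ,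
    Fintype.card_fin, nsmul_eq_mul, mul_one_div_cancel hn'.ne']
  have : ((Finset.univ.filter fun i => cell n (v i) ≠ cell n (w i)).card : ℝ) ≤ L := by
    exact_mod_cast h.le
  linarith

/-! ### Nets from a ghost sample -/

section Net

variable {X : Type*}

/-- The sample of `x`'s and `g`'s whose traces at the side `b` are read off. -/
def side {n : ℕ} (p : (Fin n → X) × (Fin n → X)) (i : Fin n) (b : Bool) : X :=
  if b then p.2 i else p.1 i

/-- Exchange of ghost and sample at the indices where `σ` is true. -/
def swapAt {n : ℕ} (σ : Fin n → Bool) (p : (Fin n → X) × (Fin n → X)) :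
    (Fin n → X) × (Fin n → X) :=
  (fun i => side p i (σ i), fun i => side p i (!σ i))

open scoped Classical in
/-- Two members of `F` agree on the first sample, but differ `L` times on the second one. -/
def badPairs (F : Set (X → ℝ)) (n L : ℕ) : Set ((Fin n → X) × (Fin n → X)) :=
  {p | ∃ f ∈ F, ∃ g ∈ F, (∀ i, cell n (f (p.1 i)) = cell n (g (p.1 i))) ∧
    L ≤ (Finset.univ.filter fun i => cell n (f (p.2 i)) ≠ cell n (g (p.2 i))).card}

/-- A cell records which levels `j / n` lie below the graph. Cell patterns on `w` are therefore
traces on `Fintype.card κ * n` points of `X × ℝ`, and Sauer-Shelah counts them. -/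
lemma exists_finset_cells {F : Set (X → ℝ)} {d : ℕ} (hd : pdim F ≤ d) {n : ℕ}
    {κ : Type*} [Fintype κ] (w : κ → X) :
    ∃ A : Finset (κ → Finset (Fin n)), A.card ≤ (Fintype.card κ * n + 1) ^ d ∧
      (∀ f ∈ F, (fun k => cell n (f (w k))) ∈ A) ∧
      ∀ a ∈ A, ∃ f ∈ F, (fun k => cell n (f (w k))) = a := by
  classical
  let pts : κ × Fin n → X × ℝ := fun kj => (w kj.1, (kj.2 : ℝ) / n)
  let A : Finset (Finset (κ × Fin n)) := Finset.univ.filter fun t => ∃ f ∈ F, trace pts f = t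
  have hA : A.card ≤ (Fintype.card κ * n + 1) ^ d := by
    have := card_traces_le hd pts (A := A) fun t ht => (Finset.mem_filter.1 ht).2
    rwa [Fintype.card_prod, Fintype.card_fin] at this
  have key : ∀ f : X → ℝ, (fun k => Finset.univ.filter fun j => (k, j) ∈ trace pts f) =
      fun k => cell n (f (w k)) := by
    intro f
    funext k
    ext j
    simp [mem_trace, mem_cell, pts]
  refine ⟨A.image fun t k => Finset.univ.filter fun j => (k, j) ∈ t, Finset.card_image_le.trans hA,
    fun f hf => Finset.mem_image.2 ⟨trace pts f, Finset.mem_filter.2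
      ⟨Finset.mem_univ _, f, hf, rfl⟩, key f⟩, fun a ha => ?_⟩
  obtain ⟨t, ht, rfl⟩ := Finset.mem_image.1 ha
  obtain ⟨f, hf, rfl⟩ := (Finset.mem_filter.1 ht).2
  exact ⟨f, hf, (key f).symm⟩

open scoped Classical in
-- The two samples with `n` levels each give `2 * n ^ 2` points. The exponent `2 * d` counts pairs
-- of patterns. The pattern set depends only on the unordered pairs of samples, so it serves all
-- swaps at once.
lemma card_swaps_bad_le {F : Set (X → ℝ)} {d : ℕ} (hd : pdim F ≤ d) {n : ℕ} (L : ℕ)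
    (p : (Fin n → X) × (Fin n → X)) :
    (Finset.univ.filter fun σ : Fin n → Bool => swapAt σ p ∈ badPairs F n L).card * 2 ^ L
      ≤ (2 * n ^ 2 + 1) ^ (2 * d) * 2 ^ n := by
  obtain ⟨A, hA, hAF, -⟩ := exists_finset_cells (n := n) hd (fun k : Fin n × Bool => side p k.1 k.2)
  let B : Finset (Fin n → Bool → Finset (Fin n)) := A.image fun a i b => a (i, b)
  have hB : B.card ≤ (2 * n ^ 2 + 1) ^ d := by
    refine Finset.card_image_le.trans (hA.trans_eq ?_)
    rw [Fintype.card_prod, Fintype.card_fin, Fintype.card_bool]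
    ring
  have hBF : ∀ f ∈ F, (fun i b => cell n (f (side p i b))) ∈ B := fun f hf =>
    Finset.mem_image.2 ⟨_, hAF f hf, rfl⟩
  have hsub : (Finset.univ.filter fun σ : Fin n → Bool => swapAt σ p ∈ badPairs F n L) ⊆
      Finset.univ.filter fun σ : Fin n → Bool => ∃ a ∈ B, ∃ b ∈ B, (∀ i, a i (σ i) = b i (σ i)) ∧
        L ≤ (Finset.univ.filter fun i => a i (!σ i) ≠ b i (!σ i)).card := by
    intro σ hσ
    have hσ' : swapAt σ p ∈ badPairs F n L := (Finset.mem_filter.1 hσ).2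
    obtain ⟨f, hf, g, hg, h1, h2⟩ := hσ'
    exact Finset.mem_filter.2 ⟨Finset.mem_univ _, _, hBF f hf, _, hBF g hg, h1, h2⟩
  refine le_trans (Nat.mul_le_mul_right _ (Finset.card_le_card hsub)) (le_trans ?_
    (Nat.mul_le_mul_right _ ((Nat.pow_le_pow_left hB 2).trans_eq (by ring))))
  convert! card_swaps_le B L

variable [MeasurableSpace X]

lemma measurableSet_badPairs {F : Set (X → ℝ)} (hF : F.Countable) (hm : ∀ f ∈ F, Measurable f)
    (n L : ℕ) : MeasurableSet (badPairs F n L) := by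
  classical
  have : badPairs F n L = ⋃ f ∈ F, ⋃ g ∈ F,
      {p | (∀ i, cell n (f (p.1 i)) = cell n (g (p.1 i))) ∧
        L ≤ (Finset.univ.filter fun i => cell n (f (p.2 i)) ≠ cell n (g (p.2 i))).card} := by
    ext p
    simp only [badPairs, Set.mem_iUnion, Set.mem_ofPred_eq, exists_prop]
  rw [this]
  refine MeasurableSet.biUnion hF fun f hf => MeasurableSet.biUnion hF fun g hg => ?_
  have hf' := hm f hf
  have hg' := hm g hg
  rw [Set.ofPred_and]
  refine MeasurableSet.inter ?_ ?_
  · rw [Set.ofPred_forall]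
    exact MeasurableSet.iInter fun i =>
      measurableSet_cell_eq n (hf'.comp ((measurable_pi_apply i).comp measurable_fst))
        (hg'.comp ((measurable_pi_apply i).comp measurable_fst))
  · have hc : Measurable fun p : (Fin n → X) × (Fin n → X) =>
        ∑ i, if cell n (f (p.2 i)) ≠ cell n (g (p.2 i)) then 1 else 0 := by
      refine Finset.measurable_sum _ fun i _ => Measurable.ite ?_ measurable_const measurable_const
      exact (measurableSet_cell_eq n (hf'.comp ((measurable_pi_apply i).comp measurable_snd))
        (hg'.comp ((measurable_pi_apply i).comp measurable_snd))).compl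
    have := measurableSet_le (measurable_const (a := L)) hc
    simpa only [Finset.card_filter] using this

lemma measurePreserving_swapAt (μ : Measure X) [IsProbabilityMeasure μ] {n : ℕ}
    (σ : Fin n → Bool) :
    MeasurePreserving (swapAt (X := X) σ)
      ((Measure.pi fun _ : Fin n => μ).prod (Measure.pi fun _ : Fin n => μ))
      ((Measure.pi fun _ : Fin n => μ).prod (Measure.pi fun _ : Fin n => μ)) := by
  have e := measurePreserving_arrowProdEquivProdArrow X X (Fin n) (fun _ => μ) (fun _ => μ)
  have h := measurePreserving_pi (fun _ : Fin n => μ.prod μ) (fun _ : Fin n => μ.prod μ)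
    (f := fun i p => if σ i then p.swap else p) (fun i => by
      by_cases hi : σ i
      · simpa [hi] using Measure.measurePreserving_swap (μ := μ) (ν := μ)
      · simp only [hi, Bool.false_eq_true, if_false]
        exact MeasurePreserving.id (μ.prod μ))
  have := e.comp (h.comp e.symm)
  convert! this using 1
  funext p
  refine Prod.ext (funext fun i => ?_) (funext fun i => ?_) <;>
  · simp only [swapAt, side, Function.comp_apply, MeasurableEquiv.arrowProdEquivProdArrow,
      Equiv.arrowProdEquivProdArrow, MeasurableEquiv.coe_mk, Equiv.coe_fn_mk,
      MeasurableEquiv.symm_mk, Equiv.coe_fn_symm_mk]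
    cases σ i <;> simp

/-- Symmetrization: coordinate swaps preserve the product measure, so the measure is an average over
all `2 ^ n` swaps, and for each fixed pair of samples few swaps are bad. -/
lemma measure_badPairs_le (μ : Measure X) [IsProbabilityMeasure μ] {F : Set (X → ℝ)}
    (hF : F.Countable) (hm : ∀ f ∈ F, Measurable f) {d : ℕ} (hd : pdim F ≤ d) (n L : ℕ) :
    ((Measure.pi fun _ : Fin n => μ).prod (Measure.pi fun _ : Fin n => μ)) (badPairs F n L) * 2 ^ L
      ≤ (2 * n ^ 2 + 1) ^ (2 * d) := by
  classical
  set ρ := (Measure.pi fun _ : Fin n => μ).prod (Measure.pi fun _ : Fin n => μ) with hρ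
  have hB := measurableSet_badPairs hF hm n L
  have h1 : (2 : ℝ≥0∞) ^ n * ρ (badPairs F n L) = ∫⁻ p, ∑ σ : Fin n → Bool,
      (swapAt σ ⁻¹' badPairs F n L).indicator 1 p ∂ρ := by
    rw [lintegral_finsetSum _ fun σ _ =>
      measurable_one.indicator ((measurePreserving_swapAt μ σ).measurable hB)]
    simp_rw [lintegral_indicator_one ((measurePreserving_swapAt μ _).measurable hB),
      hρ, (measurePreserving_swapAt μ _).measure_preimage hB.nullMeasurableSet]
    simp
  have h2 : (2 : ℝ≥0∞) ^ n * (ρ (badPairs F n L) * 2 ^ L) ≤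
      (2 : ℝ≥0∞) ^ n * (2 * n ^ 2 + 1) ^ (2 * d) := by
    rw [← mul_assoc, h1, ← lintegral_mul_const' _ _ (by simp)]
    calc _ ≤ ∫⁻ _, (2 : ℝ≥0∞) ^ n * (2 * n ^ 2 + 1) ^ (2 * d) ∂ρ := lintegral_mono fun p => ?_
      _ = _ := by rw [lintegral_const, measure_univ, mul_one]
    have h3 : ∑ σ : Fin n → Bool, (swapAt σ ⁻¹' badPairs F n L).indicator
          (1 : (Fin n → X) × (Fin n → X) → ℝ≥0∞) p =
        ((Finset.univ.filter fun σ : Fin n → Bool => swapAt σ p ∈ badPairs F n L).card : ℝ≥0∞) := by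
      rw [Finset.card_filter, Nat.cast_sum]
      refine Finset.sum_congr rfl fun σ _ => ?_
      simp [Set.indicator_apply]
    rw [h3, mul_comm ((2 : ℝ≥0∞) ^ n)]
    have h4 := (Nat.cast_le (α := ℝ≥0∞)).2 (card_swaps_bad_le hd L p)
    push_cast at h4
    exact h4
  exact (ENNReal.mul_le_mul_iff_right (by positivity) (by simp)).1 h2

/-- A finite subclass that approximates every member of `F` on most samples of size `n`. -/
lemma exists_net (μ : Measure X) [IsProbabilityMeasure μ] {F : Set (X → ℝ)}
    (hF : F.Countable) (hm : ∀ f ∈ F, Measurable f ∧ ∀ x, f x ∈ Set.Icc (0 : ℝ) 1) {d : ℕ}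
    (hd : pdim F ≤ d) {n : ℕ} (hn : 0 < n) (L : ℕ) :
    ∃ (r : (X → ℝ) → X → ℝ) (N : Finset (X → ℝ)), N.card ≤ (2 * n ^ 2 + 1) ^ d ∧ (∀ f ∈ N, f ∈ F) ∧
      (∀ f ∈ F, r f ∈ N) ∧
      (Measure.pi fun _ : Fin n => μ)
        {x | ∃ f ∈ F, (L : ℝ) + 1 < ∑ i, |f (x i) - r f (x i)|} * 2 ^ L
        ≤ (2 * n ^ 2 + 1) ^ (2 * d) := by
  classical
  set ρ := Measure.pi fun _ : Fin n => μ with hρ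
  have hbad := measure_badPairs_le μ hF (fun f hf => (hm f hf).1) hd n L
  have hB := measurableSet_badPairs hF (fun f hf => (hm f hf).1) n L
  rw [← hρ, Measure.prod_apply hB] at hbad
  -- The ghost sample is frozen at a value whose section is no larger than average. The net built
  -- from it is therefore deterministic.
  obtain ⟨g, hg⟩ := exists_le_lintegral (μ := ρ)
    (measurable_measure_prodMk_left (ν := ρ) hB).aemeasurable
  obtain ⟨A, hA, hAF, hFA⟩ := exists_finset_cells (n := n) hd g
  choose! c hcF hc using hFA
  refine ⟨fun f => c fun k => cell n (f (g k)), A.image c, ?_, ?_, ?_, ?_⟩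
  · refine Finset.card_image_le.trans (hA.trans (Nat.pow_le_pow_left ?_ d))
    rw [Fintype.card_fin]
    nlinarith
  · intro f hf
    obtain ⟨a, ha, rfl⟩ := Finset.mem_image.1 hf
    exact hcF a ha
  · exact fun f hf => Finset.mem_image_of_mem _ (hAF f hf)
  · refine le_trans (mul_le_mul_left ((measure_mono ?_).trans hg) _) hbad
    -- `f` and its representative share all cells on the ghost `g`. If they are far apart on `x`,
    -- their cells differ there at `L` or more indices, so `(g, x)` is a bad pair.
    rintro x ⟨f, hf, hx⟩
    have ha := hAF f hf
    refine ⟨f, hf, _, hcF _ ha, fun i => (congrFun (hc _ ha) i).symm, ?_⟩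
    by_contra! hlt
    exact absurd (sum_abs_sub_le_of_cell hn (fun i => (hm f hf).2 (x i))
      (fun i => (hm _ (hcF _ ha)).2 (x i)) hlt) (not_le.2 hx)

end Net

/-! ### Exponential supermartingales of independent samples -/

section Supermartingale

variable {Ω α : Type*} [MeasurableSpace Ω] [MeasurableSpace α] {P : Measure Ω}
  [IsProbabilityMeasure P] {D : Measure α} {Z : ℕ → Ω → α}

/-- The first `n` factors are functions of the samples before time `n`, which are independent of `Z
n`. Integrating out `Z n` first costs a factor at most `1`. -/
lemma lintegral_prod_le_one (hZ : ∀ t, Measurable (Z t)) (hD : ∀ t, P.map (Z t) = D)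
    (hind : iIndepFun Z P) {ψ : ℕ → (ℕ → α) → α → ℝ≥0∞}
    (hm : ∀ t, Measurable fun p : (ℕ → α) × α => ψ t p.1 p.2)
    (hpred : ∀ t z z', (∀ s < t, z s = z' s) → ψ t z = ψ t z')
    (h1 : ∀ t z, ∫⁻ a, ψ t z a ∂D ≤ 1) (n : ℕ) :
    ∫⁻ ω, ∏ t ∈ Finset.range n, ψ t (fun s => Z s ω) (Z t ω) ∂P ≤ 1 := by
  classical
  induction n with
  | zero => simp
  | succ n ih =>
    obtain ⟨ω₀⟩ := nonempty_of_isProbabilityMeasure P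
    -- A finite prefix is completed by the fixed path of `ω₀`; predictability makes the choice
    -- irrelevant.
    let ext : (Finset.range n → α) → ℕ → α := fun u s =>
      if h : s ∈ Finset.range n then u ⟨s, h⟩ else Z s ω₀
    have hext : Measurable ext := by
      refine measurable_pi_lambda _ fun s => ?_
      by_cases h : s ∈ Finset.range n
      · simpa only [ext, h, dite_true] using measurable_pi_apply _
      · simpa only [ext, h, dite_false] using measurable_const
    let U : Ω → Finset.range n → α := fun ω s => Z s ω
    have hU : Measurable U := measurable_pi_lambda _ fun s => hZ s
    have hextU : ∀ ω, ∀ s < n, ext (U ω) s = Z s ω := by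
      intro ω s hs
      simp [ext, U, hs]
    have hUZ : IndepFun U (Z n) P := by
      have := (hind.indepFun_finset (Finset.range n) {n} (by simp) hZ).comp measurable_id
        (measurable_pi_apply (⟨n, Finset.mem_singleton_self n⟩ : ({n} : Finset ℕ)))
      exact this
    let Ψ : (Finset.range n → α) → ℝ≥0∞ := fun u =>
      ∏ t ∈ Finset.range n, ψ t (ext u) (ext u t)
    have hΨ : Measurable Ψ := Finset.measurable_prod _ fun t _ =>
      (hm t).comp (hext.prodMk ((measurable_pi_apply t).comp hext))
    have hΨU : ∀ ω, Ψ (U ω) = ∏ t ∈ Finset.range n, ψ t (fun s => Z s ω) (Z t ω) := by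
      intro ω
      refine Finset.prod_congr rfl fun t ht => ?_
      rw [hextU ω t (Finset.mem_range.1 ht), hpred t (ext (U ω)) (fun s => Z s ω)
        fun s hs => hextU ω s (hs.trans (Finset.mem_range.1 ht))]
    have hn : Measurable fun p : (Finset.range n → α) × α => ψ n (ext p.1) p.2 :=
      (hm n).comp ((hext.comp measurable_fst).prodMk measurable_snd)
    have hmap := (indepFun_iff_map_prod_eq_prod_map_map hU.aemeasurable (hZ n).aemeasurable).1 hUZ
    have hDprob : IsProbabilityMeasure D := by
      rw [← hD n]; exact Measure.isProbabilityMeasure_map (hZ n).aemeasurable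
    have hUprob : IsProbabilityMeasure (P.map U) :=
      Measure.isProbabilityMeasure_map hU.aemeasurable
    calc ∫⁻ ω, ∏ t ∈ Finset.range (n + 1), ψ t (fun s => Z s ω) (Z t ω) ∂P
        = ∫⁻ ω, (fun p : (Finset.range n → α) × α => Ψ p.1 * ψ n (ext p.1) p.2)
            (U ω, Z n ω) ∂P := by
          refine lintegral_congr fun ω => ?_
          rw [Finset.prod_range_succ, ← hΨU, hpred n _ (ext (U ω)) fun s hs => (hextU ω s hs).symm]
      _ = ∫⁻ u, ∫⁻ a, Ψ u * ψ n (ext u) a ∂D ∂(P.map U) := by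
          have hΨn : Measurable fun p : (Finset.range n → α) × α => Ψ p.1 * ψ n (ext p.1) p.2 :=
            (hΨ.comp measurable_fst).mul hn
          rw [← lintegral_map hΨn (hU.prodMk (hZ n)), hmap, hD,
            lintegral_prod _ hΨn.aemeasurable]
      _ ≤ ∫⁻ u, Ψ u ∂(P.map U) := by
          refine lintegral_mono fun u => ?_
          have hnu : Measurable fun a => ψ n (ext u) a := hn.comp measurable_prodMk_left
          rw [lintegral_const_mul _ hnu]
          exact mul_le_of_le_one_right' (h1 n _)
      _ = _ := by
          rw [lintegral_map hΨ hU]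
          exact lintegral_congr hΨU
      _ ≤ 1 := ih

/-- Markov's inequality for an exponential supermartingale. -/
lemma measure_sum_ge_le (hZ : ∀ t, Measurable (Z t)) (hD : ∀ t, P.map (Z t) = D)
    (hind : iIndepFun Z P) {φ : ℕ → (ℕ → α) → α → ℝ}
    (hm : ∀ t, Measurable fun p : (ℕ → α) × α => φ t p.1 p.2)
    (hpred : ∀ t z z', (∀ s < t, z s = z' s) → φ t z = φ t z')
    (h1 : ∀ t z, ∫⁻ a, ENNReal.ofReal (Real.exp (φ t z a)) ∂D ≤ 1) (n : ℕ) (c : ℝ) :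
    P {ω | c ≤ ∑ t ∈ Finset.range n, φ t (fun s => Z s ω) (Z t ω)} ≤
      ENNReal.ofReal (Real.exp (-c)) := by
  have hψm : ∀ t, Measurable fun p : (ℕ → α) × α => ENNReal.ofReal (Real.exp (φ t p.1 p.2)) :=
    fun t => (Real.measurable_exp.comp (hm t)).ennreal_ofReal
  have h2 := lintegral_prod_le_one hZ hD hind
    (ψ := fun t z a => ENNReal.ofReal (Real.exp (φ t z a)))
    hψm (fun t z z' h => by simp only [hpred t z z' h]) h1 n
  have hmeas : Measurable fun ω =>
      ∏ t ∈ Finset.range n, ENNReal.ofReal (Real.exp (φ t (fun s => Z s ω) (Z t ω))) :=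
    Finset.measurable_prod _ fun t _ =>
      (hψm t).comp ((measurable_pi_lambda _ hZ).prodMk (hZ t))
  have h3 := meas_ge_le_lintegral_div hmeas.aemeasurable (μ := P)
    (ε := ENNReal.ofReal (Real.exp c)) (by simp [Real.exp_pos]) ENNReal.ofReal_ne_top
  refine (measure_mono fun ω hω => ?_).trans (h3.trans ?_)
  · change ENNReal.ofReal _ ≤ _
    rw [← ENNReal.ofReal_prod_of_nonneg fun _ _ => (Real.exp_pos _).le, ← Real.exp_sum]
    exact ENNReal.ofReal_le_ofReal (Real.exp_le_exp.2 hω)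
  · rw [Real.exp_neg, ENNReal.ofReal_inv_of_pos (Real.exp_pos c), ← one_div]
    exact ENNReal.div_le_div_right h2 _

/-- Normalization by `1 + s ≤ exp s`; it turns a bound on a mean into one factor of the
supermartingale. -/
lemma lintegral_exp_neg_mul_le_one {μ : Measure α} [IsProbabilityMeasure μ] {h : α → ℝ} {s : ℝ}
    (hi : Integrable h μ) (h0 : ∀ a, 0 ≤ h a) (hs : ∫ a, h a ∂μ ≤ 1 + s) :
    ∫⁻ a, ENNReal.ofReal (Real.exp (-s) * h a) ∂μ ≤ 1 := by
  rw [← ofReal_integral_eq_lintegral_ofReal (hi.const_mul _)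
    (ae_of_all _ fun a => mul_nonneg (Real.exp_pos _).le (h0 a)), integral_const_mul]
  refine ENNReal.ofReal_le_one.2 ?_
  calc Real.exp (-s) * ∫ a, h a ∂μ ≤ Real.exp (-s) * Real.exp s :=
        mul_le_mul_of_nonneg_left (hs.trans (by linarith [Real.add_one_le_exp s]))
          (Real.exp_pos _).le
    _ = 1 := by rw [← Real.exp_add]; simp

end Supermartingale

/-! ### Integration against the conditional distribution of the label -/

section Realizable

variable {X : Type*} [MeasurableSpace X] {D : Measure (X × Bool)} [IsProbabilityMeasure D]
  {fstar : X → ℝ}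

lemma integral_condKernel_of_eq {x : X} (hx : (D.condKernel x).real {true} = fstar x)
    (φ : X × Bool → ℝ) : ∫ y, φ (x, y) ∂D.condKernel x =
      fstar x * φ (x, true) + (1 - fstar x) * φ (x, false) := by
  have hf : (D.condKernel x).real {false} = 1 - fstar x := by
    rw [← hx, ← probReal_compl_eq_one_sub (measurableSet_singleton _)]
    congr 1
    ext b
    cases b <;> simp
  rw [integral_fintype .of_finite]
  simp [hx, hf]

lemma integral_of_realizes (hfs : Realizes D fstar) {φ : X × Bool → ℝ} (hi : Integrable φ D) :
    ∫ z, φ z ∂D = ∫ x, (fstar x * φ (x, true) + (1 - fstar x) * φ (x, false)) ∂D.fst := by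
  rw [← Measure.integral_condKernel hi]
  refine integral_congr_ae ?_
  filter_upwards [hfs] with x hx
  exact integral_condKernel_of_eq hx φ

lemma integrable_of_realizes (hfs : Realizes D fstar) {φ : X × Bool → ℝ} (hi : Integrable φ D) :
    Integrable (fun x => fstar x * φ (x, true) + (1 - fstar x) * φ (x, false)) D.fst := by
  refine (Integrable.integral_condKernel hi).congr ?_
  filter_upwards [hfs] with x hx
  rw [integral_condKernel_of_eq hx]

lemma integrable_of_abs_le {α : Type*} [MeasurableSpace α] {μ : Measure α} [IsFiniteMeasure μ]
    {φ : α → ℝ} (hm : Measurable φ) {B : ℝ} (hB : ∀ a, |φ a| ≤ B) : Integrable φ μ :=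
  Integrable.of_bound hm.aestronglyMeasurable B (ae_of_all _ hB)

/-! ### Exponential moments of losses, deviations and counts. -/

lemma exp_le_quadratic {s : ℝ} (hs : |s| ≤ 1) : Real.exp s ≤ 1 + s + s ^ 2 := by
  have := (abs_le.1 (Real.abs_exp_sub_one_sub_id_le hs)).2
  linarith

lemma exp_neg_le {w : ℝ} (h0 : 0 ≤ w) (h1 : w ≤ 1) : Real.exp (-w) ≤ 1 - w / 2 := by
  rw [Real.exp_neg]
  refine (inv_anti₀ (by linarith) (Real.add_one_le_exp w)).trans ?_
  rw [inv_eq_one_div, div_le_iff₀ (by linarith)]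
  nlinarith

/-- The excess of the square loss of `f` over that of `g`. -/
noncomputable def lossDiff (f g : X → ℝ) (z : X × Bool) : ℝ :=
  (f z.1 - labelVal z.2) ^ 2 - (g z.1 - labelVal z.2) ^ 2

lemma labelVal_mem (y : Bool) : labelVal y ∈ Set.Icc (0 : ℝ) 1 := by
  cases y <;> simp [labelVal]

lemma abs_sq_sub_sq_le {a b c : ℝ} (ha : a ∈ Set.Icc (0 : ℝ) 1) (hb : b ∈ Set.Icc (0 : ℝ) 1)
    (hc : c ∈ Set.Icc (0 : ℝ) 1) : |(a - c) ^ 2 - (b - c) ^ 2| ≤ 2 * |a - b| := by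
  have : (a - c) ^ 2 - (b - c) ^ 2 = (a - b) * (a + b - 2 * c) := by ring
  rw [this, abs_mul, mul_comm 2 |a - b|]
  have h2 : |a + b - 2 * c| ≤ 2 := abs_le.2
    ⟨by linarith [ha.1, hb.1, hc.2], by linarith [ha.2, hb.2, hc.1]⟩
  exact mul_le_mul_of_nonneg_left h2 (abs_nonneg _)

/-- With `u = v - p`, the exponent for a label `y` is `-u² / 2 + u (y - p)`. The linear part is
centred with variance `u² p (1 - p) ≤ u² / 4`, which is beaten by the drift `-u² / 2`. -/
lemma exp_loss_le {p v : ℝ} (hp : p ∈ Set.Icc (0 : ℝ) 1) (hv : v ∈ Set.Icc (0 : ℝ) 1) :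
    p * Real.exp (-((v - 1) ^ 2 - (p - 1) ^ 2) / 2) +
      (1 - p) * Real.exp (-((v - 0) ^ 2 - (p - 0) ^ 2) / 2) ≤ 1 - (v - p) ^ 2 / 8 := by
  obtain ⟨hp0, hp1⟩ := hp
  obtain ⟨hv0, hv1⟩ := hv
  set u := v - p with hu
  have e1 : -((v - 1) ^ 2 - (p - 1) ^ 2) / 2 = -(u ^ 2 / 2) + u * (1 - p) := by rw [hu]; ring
  have e2 : -((v - 0) ^ 2 - (p - 0) ^ 2) / 2 = -(u ^ 2 / 2) + -(u * p) := by rw [hu]; ring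
  have hu1 : |u| ≤ 1 := abs_le.2 ⟨by linarith, by linarith⟩
  have hu2 : u ^ 2 ≤ 1 := by rw [← sq_abs]; exact pow_le_one₀ (abs_nonneg _) hu1
  have b1 := exp_le_quadratic (s := u * (1 - p)) (by
    rw [abs_mul, abs_of_nonneg (by linarith : 0 ≤ 1 - p)]
    exact mul_le_one₀ hu1 (by linarith) (by linarith))
  have b2 := exp_le_quadratic (s := -(u * p)) (by
    rw [abs_neg, abs_mul, abs_of_nonneg hp0]
    exact mul_le_one₀ hu1 hp0 hp1)
  have b3 : p * Real.exp (u * (1 - p)) + (1 - p) * Real.exp (-(u * p)) ≤ 1 + u ^ 2 / 4 := by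
    have h1 := mul_le_mul_of_nonneg_left b1 hp0
    have h2 := mul_le_mul_of_nonneg_left b2 (by linarith : 0 ≤ 1 - p)
    nlinarith [mul_nonneg (sq_nonneg u) (sq_nonneg (2 * p - 1))]
  have b4 : Real.exp (-(u ^ 2 / 2)) ≤ 1 / (1 + u ^ 2 / 2) := by
    rw [Real.exp_neg, ← one_div]
    exact one_div_le_one_div_of_le (by positivity) (by linarith [Real.add_one_le_exp (u ^ 2 / 2)])
  rw [e1, e2, Real.exp_add, Real.exp_add]
  calc _ = Real.exp (-(u ^ 2 / 2)) *
        (p * Real.exp (u * (1 - p)) + (1 - p) * Real.exp (-(u * p))) := by ring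
    _ ≤ 1 / (1 + u ^ 2 / 2) * (1 + u ^ 2 / 4) := by gcongr
    _ ≤ 1 - u ^ 2 / 8 := by
        rw [div_mul_eq_mul_div, one_mul, div_le_iff₀ (by positivity)]
        nlinarith [sq_nonneg u]

lemma measurable_labelVal : Measurable labelVal := measurable_from_top

lemma measurable_lossDiff {f g : X → ℝ} (hf : Measurable f) (hg : Measurable g) :
    Measurable (lossDiff f g) :=
  (((hf.comp measurable_fst).sub (measurable_labelVal.comp measurable_snd)).pow_const 2).sub
    (((hg.comp measurable_fst).sub (measurable_labelVal.comp measurable_snd)).pow_const 2)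

/-- The squared distance of `f` and `g` on the set `q`. -/
noncomputable def sqDist (μ : Measure X) (f g : X → ℝ) (q : Set X) : ℝ :=
  ∫ x, q.indicator (fun x => (f x - g x) ^ 2) x ∂μ

open scoped Classical in
-- Conditionally on `x ∈ q` the exponential of minus half the loss has mean at most `1 - (f -
-- fstar)² / 8`, and off `q` it is `1`. Half the loss thus pays for an eighth of the squared
-- distance.
lemma lintegral_exp_loss_le_one (hfs : Realizes D fstar) (hs : Measurable fstar)
    (hs1 : ∀ x, fstar x ∈ Set.Icc (0 : ℝ) 1) {f : X → ℝ} (hf : Measurable f)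
    (hf1 : ∀ x, f x ∈ Set.Icc (0 : ℝ) 1) {q : Set X} (hq : MeasurableSet q) :
    ∫⁻ z, ENNReal.ofReal (Real.exp (sqDist D.fst f fstar q / 8 -
      (if z.1 ∈ q then lossDiff f fstar z else 0) / 2)) ∂D ≤ 1 := by
  have hq' : MeasurableSet {z : X × Bool | z.1 ∈ q} := measurable_fst hq
  have hm : Measurable fun z : X × Bool =>
      Real.exp (-((if z.1 ∈ q then lossDiff f fstar z else 0) / 2)) :=
    (((measurable_lossDiff hf hs).ite hq' measurable_const).div_const 2).neg.exp
  have hb : ∀ z : X × Bool, |(if z.1 ∈ q then lossDiff f fstar z else 0)| ≤ 2 := by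
    intro z
    split_ifs
    · refine (abs_sq_sub_sq_le (hf1 _) (hs1 _) (labelVal_mem _)).trans ?_
      have : |f z.1 - fstar z.1| ≤ 1 := abs_le.2
        ⟨by linarith [(hf1 z.1).1, (hs1 z.1).2], by linarith [(hf1 z.1).2, (hs1 z.1).1]⟩
      linarith
    · simp
  have hi : Integrable (fun z : X × Bool =>
      Real.exp (-((if z.1 ∈ q then lossDiff f fstar z else 0) / 2))) D := by
    refine integrable_of_abs_le hm (B := Real.exp 1) fun z => ?_
    rw [abs_of_pos (Real.exp_pos _)]
    exact Real.exp_le_exp.2 (by linarith [(abs_le.1 (hb z)).1])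
  have hsq : Measurable fun x => q.indicator (fun x => (f x - fstar x) ^ 2) x :=
    ((hf.sub hs).pow_const 2).indicator hq
  have hsqb : ∀ x, |q.indicator (fun x => (f x - fstar x) ^ 2) x| ≤ 1 := by
    intro x
    by_cases hx : x ∈ q
    · rw [Set.indicator_of_mem hx, abs_of_nonneg (sq_nonneg _), ← sq_abs]
      exact pow_le_one₀ (abs_nonneg _) (abs_le.2
        ⟨by linarith [(hf1 x).1, (hs1 x).2], by linarith [(hf1 x).2, (hs1 x).1]⟩)
    · simp [hx]
  have hsqi : Integrable (fun x => q.indicator (fun x => (f x - fstar x) ^ 2) x) D.fst :=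
    integrable_of_abs_le hsq hsqb
  have h := lintegral_exp_neg_mul_le_one hi (fun _ => (Real.exp_pos _).le)
    (s := -(sqDist D.fst f fstar q / 8)) ?_
  · refine le_trans (le_of_eq (lintegral_congr fun z => ?_)) h
    rw [neg_neg, ← Real.exp_add, sub_eq_add_neg]
  rw [integral_of_realizes hfs hi]
  calc _ ≤ ∫ x, (1 - q.indicator (fun x => (f x - fstar x) ^ 2) x / 8) ∂D.fst := ?_
    _ = _ := by
        rw [integral_sub (integrable_const _) (hsqi.div_const 8), integral_div]
        simp [sqDist, sub_eq_add_neg]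
  refine integral_mono_of_nonneg (ae_of_all _ fun x => ?_)
    ((integrable_const _).sub (hsqi.div_const 8)) (ae_of_all _ fun x => ?_)
  · exact add_nonneg (mul_nonneg (hs1 x).1 (Real.exp_pos _).le)
      (mul_nonneg (by linarith [(hs1 x).2]) (Real.exp_pos _).le)
  · by_cases hx : x ∈ q
    · simp only [hx, if_true, Set.indicator_of_mem, lossDiff, labelVal,
        Bool.false_eq_true, if_false]
      simpa only [neg_div] using exp_loss_le (hs1 x) (hf1 x)
    · simp [hx]

lemma lintegral_exp_dev_le_one {α : Type*} [MeasurableSpace α] {μ : Measure α}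
    [IsProbabilityMeasure μ] {w : α → ℝ} (hw : Measurable w) (hw1 : ∀ a, w a ∈ Set.Icc (0 : ℝ) 1) :
    ∫⁻ a, ENNReal.ofReal (Real.exp ((∫ b, w b ∂μ) / 2 - w a)) ∂μ ≤ 1 := by
  have hi : Integrable w μ := integrable_of_abs_le hw fun a => abs_le.2
    ⟨by linarith [(hw1 a).1], (hw1 a).2⟩
  have hie : Integrable (fun a => Real.exp (-w a)) μ := by
    refine integrable_of_abs_le hw.neg.exp (B := 1) fun a => ?_
    rw [abs_of_pos (Real.exp_pos _)]
    exact Real.exp_le_one_iff.2 (by linarith [(hw1 a).1])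
  have h := lintegral_exp_neg_mul_le_one hie (fun _ => (Real.exp_pos _).le)
    (s := -((∫ b, w b ∂μ) / 2)) ?_
  · refine le_trans (le_of_eq (lintegral_congr fun z => ?_)) h
    rw [neg_neg, ← Real.exp_add, sub_eq_add_neg]
  have h1 : (1 : ℝ) = ∫ _, (1 : ℝ) ∂μ := by simp
  rw [← sub_eq_add_neg, h1, ← integral_div, ← integral_sub (integrable_const _) (hi.div_const 2)]
  exact integral_mono hie ((integrable_const _).sub (hi.div_const 2)) fun a =>
    exp_neg_le (hw1 a).1 (hw1 a).2

open scoped Classical in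
-- Since `e < 3`, the exponential of an indicator is at most `1 + 2 * indicator`; this is the source
-- of the factor `2` in the bound on the number of queries.
lemma lintegral_exp_count_le_one {α : Type*} [MeasurableSpace α] {μ : Measure α}
    [IsProbabilityMeasure μ] {q : Set α} (hq : MeasurableSet q) :
    ∫⁻ a, ENNReal.ofReal (Real.exp ((if a ∈ q then 1 else 0) - 2 * μ.real q)) ∂μ ≤ 1 := by
  have hle : ∀ a, Real.exp (if a ∈ q then 1 else 0) ≤ 1 + 2 * q.indicator 1 a := by
    intro a
    by_cases ha : a ∈ q
    · simp only [ha, if_true, Set.indicator_of_mem, Pi.one_apply]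
      linarith [Real.exp_one_lt_three]
    · simp [ha]
  have hqi : Integrable (q.indicator (1 : α → ℝ)) μ := (integrable_const _).indicator hq
  have hie : Integrable (fun a => Real.exp (if a ∈ q then 1 else 0)) μ := by
    refine integrable_of_abs_le (measurable_const.ite hq measurable_const).exp
      (B := 3) fun a => ?_
    rw [abs_of_pos (Real.exp_pos _)]
    split_ifs
    · exact Real.exp_one_lt_three.le
    · simp
  have h := lintegral_exp_neg_mul_le_one hie (fun _ => (Real.exp_pos _).le)
    (s := 2 * μ.real q) ?_
  · refine le_trans (le_of_eq (lintegral_congr fun z => ?_)) h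
    rw [← Real.exp_add, sub_eq_neg_add]
  calc _ ≤ ∫ a, (1 + 2 * q.indicator (1 : α → ℝ) a) ∂μ :=
        integral_mono hie ((integrable_const _).add (hqi.const_mul 2)) hle
    _ = _ := by
        rw [integral_add (integrable_const _) (hqi.const_mul 2), integral_const_mul,
          integral_indicator_one hq]
        simp

end Realizable

/-! ### Measurable random lists -/

section MeasurableList

variable {Ω α β : Type*} [MeasurableSpace Ω] [MeasurableSpace α] [MeasurableSpace β]

/-- A random list is measurable if its length is, and its entries are for each given length. -/
def MeasurableList (G : Ω → List α) : Prop :=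
  ∀ k, MeasurableSet {w | (G w).length = k} ∧
    ∃ g : Ω → Fin k → α, Measurable g ∧ ∀ w, (G w).length = k → G w = List.ofFn (g w)

/-- Splitting by the length reduces an event about a random list to countably many events about
tuples. -/
lemma MeasurableList.measurableSet {G : Ω → List α} (hG : MeasurableList G) {h : Ω → β}
    (hh : Measurable h) {B : List α → β → Prop}
    (hB : ∀ k, MeasurableSet {p : (Fin k → α) × β | B (List.ofFn p.1) p.2}) :
    MeasurableSet {w | B (G w) (h w)} := by
  choose hl g hg hGg using hG
  have : {w | B (G w) (h w)} = ⋃ k, {w | (G w).length = k} ∩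
      (fun w => (g k w, h w)) ⁻¹' {p : (Fin k → α) × β | B (List.ofFn p.1) p.2} := by
    ext w
    simp only [Set.mem_iUnion, Set.mem_inter_iff, Set.mem_preimage, Set.mem_ofPred_eq]
    constructor
    · intro hw
      exact ⟨_, rfl, by rwa [← hGg _ w rfl]⟩
    · rintro ⟨k, hk, hw⟩
      rwa [hGg k w hk]
  rw [this]
  exact MeasurableSet.iUnion fun k => (hl k).inter ((hg k).prodMk hh (hB k))

lemma measurableList_nil [Nonempty α] : MeasurableList fun _ : Ω => ([] : List α) := by
  intro k
  refine ⟨MeasurableSet.const _, fun _ _ => Classical.arbitrary α, measurable_const, ?_⟩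
  rintro w rfl
  simp

open scoped Classical in
lemma MeasurableList.append_ite {G : Ω → List α} (hG : MeasurableList G) {a : Ω → α}
    (ha : Measurable a) {q : Ω → Prop} (hq : MeasurableSet {w | q w}) :
    MeasurableList fun w => G w ++ if q w then [a w] else [] := by
  choose hl g hg hGg using hG
  intro k
  cases k with
  | zero =>
    constructor
    · have : {w | (G w ++ if q w then [a w] else []).length = 0} =
          {w | (G w).length = 0} ∩ {w | q w}ᶜ := by
        ext w
        by_cases h : q w <;> simp [h]
      rw [this]
      exact (hl 0).inter hq.compl
    · refine ⟨g 0, hg 0, fun w hw => ?_⟩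
      rw [List.length_eq_zero_iff] at hw
      simp [hw]
  | succ k =>
    constructor
    · have : {w | (G w ++ if q w then [a w] else []).length = k + 1} =
          ({w | (G w).length = k} ∩ {w | q w}) ∪ ({w | (G w).length = k + 1} ∩ {w | q w}ᶜ) := by
        ext w
        by_cases h : q w <;> simp [h]
      rw [this]
      exact ((hl k).inter hq).union ((hl (k + 1)).inter hq.compl)
    -- Length `k + 1` arises either from length `k` with an appended entry or from length `k + 1`
    -- unchanged.
    · refine ⟨fun w => if q w then Fin.snoc (g k w) (a w) else g (k + 1) w, ?_, fun w hw => ?_⟩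
      · refine Measurable.ite hq (measurable_pi_lambda _ fun i => ?_) (hg (k + 1))
        refine Fin.lastCases ?_ (fun i => ?_) i
        · simpa using ha
        · simpa [Function.comp_def] using (measurable_pi_apply i).comp (hg k)
      · by_cases h : q w
        · simp only [h, if_true, List.length_append, List.length_singleton,
            Nat.add_right_cancel_iff] at hw ⊢
          rw [List.ofFn_succ']
          simp [hGg k w hw]
        · simp only [h, if_false, List.append_nil] at hw ⊢
          exact hGg (k + 1) w hw

open scoped Classical in
lemma MeasurableList.append_filter {G : Ω → List α} (hG : MeasurableList G) {z : Ω → ℕ → α}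
    (hz : ∀ t, Measurable fun w => z w t) {q : Ω → α → Prop}
    (hq : ∀ t, MeasurableSet {w | q w (z w t)}) (l : List ℕ) :
    MeasurableList fun w => G w ++ (l.map (z w)).filter fun a => decide (q w a) := by
  induction l using List.reverseRecOn with
  | nil => simpa using hG
  | append_singleton l t ih =>
    have := ih.append_ite (hz t) (hq t)
    convert! this using 2 with w
    by_cases h : q w (z w t) <;> simp [h]

end MeasurableList

/-! ### The epochs -/

lemma tau_strictMono : StrictMono tau := by
  refine strictMono_nat_of_lt_succ fun m => ?_
  cases m with
  | zero => simp [tau]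
  | succ m => exact Nat.pow_lt_pow_right (by norm_num) (Nat.lt_succ_self _)

/-- The index `m` such that the time `t ≥ 1` is processed in epoch `m + 1`. -/
def epochOf (t : ℕ) : ℕ := Nat.clog 2 t - 1

/-- The first epoch holds the times `1` and `2`, as `tau` jumps from `0` to `2`. Time `1` is a
separate case: `Nat.clog 2 1 = 0`, and truncated subtraction keeps it in that epoch. -/
lemma tau_epochOf_lt {t : ℕ} (ht : 0 < t) : tau (epochOf t) < t := by
  unfold epochOf
  rcases Nat.lt_or_ge 1 t with h | h
  · have h1 := Nat.pow_pred_clog_lt_self (b := 2) (by norm_num) h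
    rw [Nat.pred_eq_sub_one] at h1
    cases hc : Nat.clog 2 t - 1 with
    | zero => exact ht
    | succ m => rwa [hc] at h1
  · have : t = 1 := by omega
    subst this
    simp [tau]

lemma le_tau_epochOf (t : ℕ) : t ≤ tau (epochOf t + 1) := by
  refine (Nat.le_pow_clog (b := 2) (by norm_num) t).trans ?_
  exact Nat.pow_le_pow_right (by norm_num) (by unfold epochOf; omega)

lemma epochOf_eq {m t : ℕ} (h1 : tau m < t) (h2 : t ≤ tau (m + 1)) : epochOf t = m := by
  have h3 := tau_epochOf_lt (by omega : 0 < t)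
  have h4 := le_tau_epochOf t
  have h5 := tau_strictMono.lt_iff_lt.1 (h1.trans_le h4)
  have h6 := tau_strictMono.lt_iff_lt.1 (h3.trans_le h2)
  omega

section Algorithm

variable {X : Type*} (F : Set (X → ℝ)) (oracle : List (X × Bool) → X → ℝ) (γ : ℝ) (M : ℕ) (C : ℝ)

/-- The active set of epoch `m + 1`. -/
noncomputable def active (z : ℕ → X × Bool) (m : ℕ) : Set (X → ℝ) :=
  activeSet F oracle (queried F oracle γ M C z m) (beta M C (m + 1))

/-- The empirical minimizer of epoch `m + 1`. -/
noncomputable def minimizer (z : ℕ → X × Bool) (m : ℕ) : X → ℝ :=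
  oracle (queried F oracle γ M C z m)

/-- The set of inputs whose labels are queried in epoch `m + 1`. -/
def region (z : ℕ → X × Bool) (m : ℕ) : Set X :=
  {x | Queries (active F oracle γ M C z m) (minimizer F oracle γ M C z m) γ x}

variable {F oracle γ M C}

open scoped Classical in
lemma sum_filter_range' {α : Type*} (z : ℕ → α) (p : α → Prop) (g : α → ℝ) (a k : ℕ) :
    ((((List.range' (a + 1) k).map z).filter fun w => decide (p w)).map g).sum =
      ∑ t ∈ Finset.Ioc a (a + k), if p (z t) then g (z t) else 0 := by
  induction k with
  | zero => simp
  | succ k ih =>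
    rw [List.range'_concat, List.map_append, List.filter_append, List.map_append, List.sum_append,
      ih, ← add_assoc, ← Finset.insert_Ioc_right_eq_Ioc_add_one (by omega),
      Finset.sum_insert (by simp), add_comm]
    congr 1
    by_cases h : p (z (a + k + 1)) <;>
      simp [h, add_right_comm a 1 k]

open scoped Classical in
lemma queried_succ (z : ℕ → X × Bool) (m : ℕ) :
    queried F oracle γ M C z (m + 1) = queried F oracle γ M C z m ++
      ((List.range' (tau m + 1) (tau (m + 1) - tau m)).map z).filter
        fun w => decide (w.1 ∈ region F oracle γ M C z m) := by
  rfl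

open scoped Classical in
lemma sum_map_queried (z : ℕ → X × Bool) (g : X × Bool → ℝ) (m : ℕ) :
    ((queried F oracle γ M C z m).map g).sum = ∑ t ∈ Finset.Ioc 0 (tau m),
      if (z t).1 ∈ region F oracle γ M C z (epochOf t) then g (z t) else 0 := by
  induction m with
  | zero => simp [queried, tau]
  | succ m ih =>
    have hlt : tau m < tau (m + 1) := tau_strictMono (Nat.lt_succ_self m)
    rw [queried_succ, List.map_append, List.sum_append, ih,
      sum_filter_range' z (fun w => w.1 ∈ region F oracle γ M C z m),
      Nat.add_sub_cancel' hlt.le,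
      ← Finset.sum_Ioc_consecutive _ (Nat.zero_le _) hlt.le]
    congr 1
    refine Finset.sum_congr rfl fun t ht => ?_
    rw [epochOf_eq (Finset.mem_Ioc.1 ht).1 (Finset.mem_Ioc.1 ht).2]

variable (F oracle γ M C) in
lemma queried_congr {z z' : ℕ → X × Bool} (m : ℕ) (h : ∀ s ≤ tau m, z s = z' s) :
    queried F oracle γ M C z m = queried F oracle γ M C z' m := by
  classical
  induction m with
  | zero => rfl
  | succ m ih =>
    have hlt : tau m < tau (m + 1) := tau_strictMono (Nat.lt_succ_self m)
    have e := ih fun s hs => h s (hs.trans hlt.le)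
    rw [queried_succ, queried_succ, region, region, active, active, minimizer, minimizer, e]
    congr 2
    refine List.map_congr_left fun t ht => h t ?_
    have := (List.mem_range'_1.1 ht).2
    omega

variable (F oracle γ M C) in
-- Predictability of the query region: its epoch starts strictly after the samples that determine
-- it.
lemma region_epochOf_congr {z z' : ℕ → X × Bool} {t : ℕ} (ht : 0 < t)
    (h : ∀ s < t, z s = z' s) :
    region F oracle γ M C z (epochOf t) = region F oracle γ M C z' (epochOf t) := by
  have e := queried_congr F oracle γ M C (epochOf t)
    fun s hs => h s (hs.trans_lt (tau_epochOf_lt ht))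
  rw [region, region, active, active, minimizer, minimizer, e]

lemma epochClassifier_eq_none_iff {G : Set (X → ℝ)} {fhat : X → ℝ} {x : X} :
    epochClassifier G fhat γ x = none ↔
      Set.Icc (lcb G x) (ucb G x) ⊆ Set.Icc (1 / 2 - γ) (1 / 2 + γ) := by
  unfold epochClassifier
  split_ifs <;> simp_all

/-- The empirical minimizer drops out: querying depends only on the confidence interval. Hence the
regions are monotone in the active set, and their measurability needs only that of the bounds. -/
lemma queries_iff {G : Set (X → ℝ)} {fhat : X → ℝ} {x : X} :
    Queries G fhat γ x ↔ (lcb G x < 1 / 2 ∧ 1 / 2 < ucb G x) ∧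
      ¬(1 / 2 - γ ≤ lcb G x ∧ ucb G x ≤ 1 / 2 + γ) := by
  rw [Queries, Set.mem_Ioo, Ne, epochClassifier_eq_none_iff]
  refine and_congr_right fun h => ?_
  rw [Set.Icc_subset_Icc_iff (h.1.trans h.2).le]

variable [MeasurableSpace X]

variable (F oracle) in
/-- Joint measurability of the confidence bounds in the sample and the input. -/
def MeasurableBounds : Prop :=
  ∀ (n : ℕ) (r : ℝ), 0 ≤ r →
    Measurable (fun p : (Fin n → X × Bool) × X =>
      lcb (activeSet F oracle (List.ofFn p.1) r) p.2) ∧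
    Measurable (fun p : (Fin n → X × Bool) × X =>
      ucb (activeSet F oracle (List.ofFn p.1) r) p.2)

lemma measurableSet_queries (hmeas : MeasurableBounds F oracle) {r : ℝ} (hr : 0 ≤ r) (n : ℕ) :
    MeasurableSet {p : (Fin n → X × Bool) × X |
      Queries (activeSet F oracle (List.ofFn p.1) r) (oracle (List.ofFn p.1)) γ p.2} := by
  obtain ⟨hl, hu⟩ := hmeas n r hr
  simp only [queries_iff]
  exact ((measurableSet_lt hl measurable_const).inter (measurableSet_lt measurable_const hu)).inter
    ((measurableSet_le measurable_const hl).inter (measurableSet_le hu measurable_const)).compl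

lemma beta_succ_nonneg (hC : 0 ≤ C) {m : ℕ} (hm : m ≤ M) : 0 ≤ beta M C (m + 1) := by
  have : (m : ℝ) ≤ M := by exact_mod_cast hm
  refine mul_nonneg ?_ hC
  push_cast
  linarith

lemma measurableList_queried [Nonempty X] (hmeas : MeasurableBounds F oracle) (hC : 0 ≤ C) {m : ℕ}
    (hm : m ≤ M) : MeasurableList fun z : ℕ → X × Bool => queried F oracle γ M C z m := by
  classical
  induction m with
  | zero => exact measurableList_nil
  | succ m ih =>
    have ih := ih (by omega)
    simp only [queried_succ]
    refine ih.append_filter measurable_pi_apply (fun t => ?_) _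
    exact ih.measurableSet (measurable_fst.comp (measurable_pi_apply t))
      (B := fun S x => Queries (activeSet F oracle S (beta M C (m + 1))) (oracle S) γ x)
      fun k => measurableSet_queries hmeas (beta_succ_nonneg hC (by omega)) k

lemma measurableSet_region [Nonempty X] (hmeas : MeasurableBounds F oracle) (hC : 0 ≤ C) {m : ℕ}
    (hm : m ≤ M) : MeasurableSet {p : (ℕ → X × Bool) × X | p.2 ∈ region F oracle γ M C p.1 m} := by
  have h : MeasurableList fun p : (ℕ → X × Bool) × X => queried F oracle γ M C p.1 m := by
    intro k
    obtain ⟨h1, g, hg, h2⟩ := measurableList_queried (γ := γ) hmeas hC hm k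
    exact ⟨measurable_fst h1, fun p => g p.1, hg.comp measurable_fst, fun p => h2 p.1⟩
  exact h.measurableSet measurable_snd
    (B := fun S x => Queries (activeSet F oracle S (beta M C (m + 1))) (oracle S) γ x)
    fun k => measurableSet_queries hmeas (beta_succ_nonneg hC hm) k

end Algorithm

/-! ### Uniform concentration over the class -/

/-- Exponents outside the window are set to zero. This restricts the hypotheses to the window, as
the regions are shown to be measurable only up to epoch `M`. -/
lemma measure_sum_Ioc_ge_le {Ω α : Type*} [MeasurableSpace Ω] [MeasurableSpace α] {P : Measure Ω}
    [IsProbabilityMeasure P] {D : Measure α} {Z : ℕ → Ω → α} (hZ : ∀ t, Measurable (Z t))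
    (hD : ∀ t, P.map (Z t) = D) (hind : iIndepFun Z P) {φ : ℕ → (ℕ → α) → α → ℝ} {a b : ℕ}
    (hm : ∀ t ∈ Finset.Ioc a b, Measurable fun p : (ℕ → α) × α => φ t p.1 p.2)
    (hpred : ∀ t ∈ Finset.Ioc a b, ∀ z z', (∀ s < t, z s = z' s) → φ t z = φ t z')
    (h1 : ∀ t ∈ Finset.Ioc a b, ∀ z, ∫⁻ x, ENNReal.ofReal (Real.exp (φ t z x)) ∂D ≤ 1) (c : ℝ) :
    P {ω | c ≤ ∑ t ∈ Finset.Ioc a b, φ t (fun s => Z s ω) (Z t ω)} ≤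
      ENNReal.ofReal (Real.exp (-c)) := by
  have hDprob : IsProbabilityMeasure D := by
    rw [← hD 0]; exact Measure.isProbabilityMeasure_map (hZ 0).aemeasurable
  have h := measure_sum_ge_le hZ hD hind
    (φ := fun t z x => if t ∈ Finset.Ioc a b then φ t z x else 0) (fun t => ?_)
    (fun t z z' hz => ?_) (fun t z => ?_) (b + 1) c
  · refine (measure_mono fun ω hω => ?_).trans h
    rw [Set.mem_ofPred_eq] at hω ⊢
    refine le_trans hω (le_of_eq ?_)
    rw [← Finset.sum_filter]
    refine Finset.sum_congr ?_ fun _ _ => rfl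
    ext t
    simp only [Finset.mem_filter, Finset.mem_range, Finset.mem_Ioc]
    omega
  · by_cases ht : t ∈ Finset.Ioc a b
    · simpa only [ht, if_true] using hm t ht
    · simp only [ht, if_false]
      exact measurable_const
  · by_cases ht : t ∈ Finset.Ioc a b
    · simp only [ht, if_true, hpred t ht z z' hz]
    · simp only [ht, if_false]
  · by_cases ht : t ∈ Finset.Ioc a b
    · simpa only [ht, if_true] using h1 t ht z
    · simp [ht]

lemma abs_sub_le_one {a b : ℝ} (ha : a ∈ Set.Icc (0 : ℝ) 1) (hb : b ∈ Set.Icc (0 : ℝ) 1) :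
    |a - b| ≤ 1 :=
  abs_le.2 ⟨by linarith [ha.1, hb.2], by linarith [ha.2, hb.1]⟩

lemma abs_indicator_sq_le {X : Type*} {f g : X → ℝ} (hf1 : ∀ x, f x ∈ Set.Icc (0 : ℝ) 1)
    (hg1 : ∀ x, g x ∈ Set.Icc (0 : ℝ) 1) (q : Set X) (x : X) :
    |q.indicator (fun x => (f x - g x) ^ 2) x| ≤ 1 := by
  by_cases hx : x ∈ q
  · rw [Set.indicator_of_mem hx, abs_of_nonneg (sq_nonneg _), ← sq_abs]
    exact pow_le_one₀ (abs_nonneg _) (abs_sub_le_one (hf1 x) (hg1 x))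
  · simp [hx]

/-! ### Squared distances restricted to a region. -/

section SqDist

variable {X : Type*} [MeasurableSpace X] {μ : Measure X} [IsProbabilityMeasure μ]

lemma measurable_indicator_sq {f g : X → ℝ} (hf : Measurable f) (hg : Measurable g) {q : Set X}
    (hq : MeasurableSet q) : Measurable (q.indicator fun x => (f x - g x) ^ 2) :=
  ((hf.sub hg).pow_const 2).indicator hq

lemma integrable_indicator_sq {f g : X → ℝ} (hf : Measurable f)
    (hf1 : ∀ x, f x ∈ Set.Icc (0 : ℝ) 1) (hg : Measurable g) (hg1 : ∀ x, g x ∈ Set.Icc (0 : ℝ) 1)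
    {q : Set X} (hq : MeasurableSet q) :
    Integrable (q.indicator fun x => (f x - g x) ^ 2) μ :=
  integrable_of_abs_le (measurable_indicator_sq hf hg hq) (abs_indicator_sq_le hf1 hg1 q)

lemma sqDist_le_add {f f' g : X → ℝ} (hf : Measurable f) (hf1 : ∀ x, f x ∈ Set.Icc (0 : ℝ) 1)
    (hf' : Measurable f') (hf1' : ∀ x, f' x ∈ Set.Icc (0 : ℝ) 1) (hg : Measurable g)
    (hg1 : ∀ x, g x ∈ Set.Icc (0 : ℝ) 1) {q : Set X} (hq : MeasurableSet q) :
    sqDist μ f g q ≤ sqDist μ f' g q + 2 * ∫ x, |f x - f' x| ∂μ := by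
  have hi : Integrable (fun x => |f x - f' x|) μ :=
    integrable_of_abs_le (hf.sub hf').abs fun x => by
      rw [abs_abs]; exact abs_sub_le_one (hf1 x) (hf1' x)
  have hi' := integrable_indicator_sq (μ := μ) hf' hf1' hg hg1 hq
  rw [sqDist, sqDist, ← integral_const_mul, ← integral_add hi' (hi.const_mul 2)]
  refine integral_mono (integrable_indicator_sq hf hf1 hg hg1 hq) (hi'.add (hi.const_mul 2))
    fun x => ?_
  by_cases hx : x ∈ q
  · simp only [Set.indicator_of_mem hx]
    linarith [(abs_le.1 (abs_sq_sub_sq_le (hf1 x) (hf1' x) (hg1 x))).2]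
  · simp [hx]

lemma tendsto_sqDist {u : ℕ → X → ℝ} {f g : X → ℝ} (hu : ∀ n, Measurable (u n))
    (hu1 : ∀ n x, u n x ∈ Set.Icc (0 : ℝ) 1) (hg : Measurable g)
    (hg1 : ∀ x, g x ∈ Set.Icc (0 : ℝ) 1) {q : Set X} (hq : MeasurableSet q)
    (h : ∀ x, Tendsto (fun n => u n x) atTop (𝓝 (f x))) :
    Tendsto (fun n => sqDist μ (u n) g q) atTop (𝓝 (sqDist μ f g q)) := by
  refine tendsto_integral_of_dominated_convergence (fun _ => 1)
    (fun n => (measurable_indicator_sq (hu n) hg hq).aestronglyMeasurable) (integrable_const _)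
    (fun n => ae_of_all _ (abs_indicator_sq_le (hu1 n) hg1 q)) (ae_of_all _ fun x => ?_)
  by_cases hx : x ∈ q
  · simp only [Set.indicator_of_mem hx]
    exact ((h x).sub_const _).pow 2
  · simp [hx]

lemma measurable_sqDist {β : Type*} [MeasurableSpace β] {f g : X → ℝ} (hf : Measurable f)
    (hg : Measurable g) {q : β → Set X} (hq : MeasurableSet {p : β × X | p.2 ∈ q p.1}) :
    Measurable fun z => sqDist μ f g (q z) := by
  classical
  have : Measurable fun p : β × X => (q p.1).indicator (fun x => (f x - g x) ^ 2) p.2 := by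
    simp only [Set.indicator_apply]
    exact Measurable.ite hq (((hf.comp measurable_snd).sub (hg.comp measurable_snd)).pow_const 2)
      measurable_const
  exact (StronglyMeasurable.integral_prod_right' (f := fun p : β × X =>
    (q p.1).indicator (fun x => (f x - g x) ^ 2) p.2) this.stronglyMeasurable).measurable

end SqDist

lemma sum_Ioc_zero_eq_sum_fin (n : ℕ) (h : ℕ → ℝ) :
    ∑ t ∈ Finset.Ioc 0 n, h t = ∑ i : Fin n, h (i + 1) := by
  rw [Fin.sum_univ_eq_sum_range (fun i => h (i + 1)) n]
  induction n with
  | zero => simp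
  | succ n ih =>
    rw [← Finset.insert_Ioc_right_eq_Ioc_add_one (Nat.zero_le n), Finset.sum_insert (by simp), ih,
      Finset.sum_range_succ, add_comm]

lemma map_fst_sample {X Ω : Type*} [MeasurableSpace X] [MeasurableSpace Ω] {P : Measure Ω}
    [IsProbabilityMeasure P] {D : Measure (X × Bool)} {Z : ℕ → Ω → X × Bool}
    (hZ : ∀ t, Measurable (Z t)) (hD : ∀ t, P.map (Z t) = D) (hind : iIndepFun Z P) (n : ℕ) :
    P.map (fun ω (i : Fin n) => (Z (i + 1) ω).1) = Measure.pi fun _ : Fin n => D.fst := by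
  have h := (hind.precomp (g := fun i : Fin n => (i : ℕ) + 1)
    (fun i j h => Fin.ext (Nat.add_right_cancel h))).comp (fun _ => Prod.fst)
    fun _ => measurable_fst
  have hm : ∀ i : Fin n, Measurable fun ω => (Z (i + 1) ω).1 :=
    fun i => measurable_fst.comp (hZ _)
  have h' := (iIndepFun_iff_map_fun_eq_pi_map fun i => (hm i).aemeasurable).1 h
  rw [h']
  congr 1
  funext i
  rw [← hD (i + 1), Measure.fst, Measure.map_map measurable_fst (hZ _)]
  rfl

/-! ### Concentration along the run for a fixed function. -/

section Concentration

variable {X Ω : Type*} [MeasurableSpace X] [MeasurableSpace Ω] {P : Measure Ω}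
  [IsProbabilityMeasure P] {D : Measure (X × Bool)} [IsProbabilityMeasure D]
  {Z : ℕ → Ω → X × Bool}

/-- The bound on the mean distance is deterministic although it comes from samples. If it failed for
some `f`, then almost surely either the sample distance would be large or its lower deviation would
occur, yet both events are too unlikely to cover the whole space. -/
lemma exists_net_sample (hZ : ∀ t, Measurable (Z t)) (hD : ∀ t, P.map (Z t) = D)
    (hind : iIndepFun Z P) {F : Set (X → ℝ)} (hF : F.Countable)
    (hm : ∀ f ∈ F, Measurable f ∧ ∀ x, f x ∈ Set.Icc (0 : ℝ) 1) {d : ℕ} (hd : pdim F ≤ d)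
    {n : ℕ} (hn : 0 < n) {L : ℕ} {δ : ℝ} (hδ : δ ≤ 1)
    (hL : (2 * (n : ℝ) ^ 2 + 1) ^ (2 * d) ≤ δ / 2 * 2 ^ L) :
    ∃ (r : (X → ℝ) → X → ℝ) (N : Finset (X → ℝ)), N.card ≤ (2 * n ^ 2 + 1) ^ d ∧ (∀ f ∈ N, f ∈ F) ∧
      (∀ f ∈ F, r f ∈ N) ∧
      P {ω | ∃ f ∈ F, (L : ℝ) + 1 < ∑ t ∈ Finset.Ioc 0 n, |f (Z t ω).1 - r f (Z t ω).1|}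
        ≤ ENNReal.ofReal (δ / 2) ∧
      ∀ f ∈ F, n * ∫ x, |f x - r f x| ∂D.fst ≤ 2 * L + 4 := by
  obtain ⟨r, N, hN, hNF, hr, hbad⟩ := exists_net D.fst hF hm hd hn L
  have hbad' : P {ω | ∃ f ∈ F, (L : ℝ) + 1 < ∑ t ∈ Finset.Ioc 0 n, |f (Z t ω).1 - r f (Z t ω).1|}
        ≤ ENNReal.ofReal (δ / 2) := by
    have h1 : P {ω | ∃ f ∈ F, (L : ℝ) + 1 <
        ∑ t ∈ Finset.Ioc 0 n, |f (Z t ω).1 - r f (Z t ω).1|} ≤ (Measure.pi fun _ : Fin n => D.fst)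
        {x | ∃ f ∈ F, (L : ℝ) + 1 < ∑ i, |f (x i) - r f (x i)|} := by
      rw [← map_fst_sample hZ hD hind n]
      refine le_trans (le_of_eq ?_) (Measure.le_map_apply
        (measurable_pi_lambda _ fun i => measurable_fst.comp (hZ _)).aemeasurable _)
      congr 1
      ext ω
      simp only [Set.mem_preimage, Set.mem_ofPred_eq, sum_Ioc_zero_eq_sum_fin]
      rfl
    have h2 : (2 : ℝ≥0∞) ^ L ≠ 0 := by positivity
    have h3 : (2 : ℝ≥0∞) ^ L ≠ ∞ := by simp
    refine (ENNReal.mul_le_mul_iff_left h2 h3).1 ((mul_le_mul_left h1 _).trans (hbad.trans ?_))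
    have h4 := ENNReal.ofReal_le_ofReal hL
    rw [ENNReal.ofReal_mul' (by positivity), ENNReal.ofReal_pow (by positivity),
      ENNReal.ofReal_pow (by positivity), ENNReal.ofReal_add (by positivity) (by positivity),
      ENNReal.ofReal_mul (by positivity), ENNReal.ofReal_pow (by positivity)] at h4
    simpa using h4
  refine ⟨r, N, hN, hNF, hr, hbad', fun f hf => ?_⟩
  by_contra! hlt
  have hrf := hm _ (hNF _ (hr f hf))
  have hw : Measurable fun x => |f x - r f x| := ((hm f hf).1.sub hrf.1).abs
  have hdev := measure_sum_Ioc_ge_le hZ hD hind (a := 0) (b := n)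
    (φ := fun _ _ z => (∫ x, |f x - r f x| ∂D.fst) / 2 - |f z.1 - r f z.1|)
    (fun t _ => measurable_const.sub (hw.comp (measurable_fst.comp measurable_snd)))
    (fun _ _ _ _ _ => rfl) (fun t _ _ => by
      have h := lintegral_exp_dev_le_one (μ := D.fst) hw fun x =>
        ⟨abs_nonneg _, abs_sub_le_one ((hm f hf).2 x) (hrf.2 x)⟩
      rwa [Measure.fst, lintegral_map (by fun_prop) measurable_fst] at h) 1
  -- Half of `n` times the mean distance exceeds `L + 2`. A sample distance at most `L + 1` then
  -- leaves a deviation of at least `1`. The two probabilities are at most `1 / 2` and `exp (-1) < 1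
  -- / 2`.
  have huniv : (Set.univ : Set Ω) ⊆ {ω | ∃ f ∈ F, (L : ℝ) + 1 <
      ∑ t ∈ Finset.Ioc 0 n, |f (Z t ω).1 - r f (Z t ω).1|} ∪ {ω | 1 ≤ ∑ t ∈ Finset.Ioc 0 n,
        ((∫ x, |f x - r f x| ∂D.fst) / 2 - |f (Z t ω).1 - r f (Z t ω).1|)} := by
    intro ω _
    by_cases h : (L : ℝ) + 1 < ∑ t ∈ Finset.Ioc 0 n, |f (Z t ω).1 - r f (Z t ω).1|
    · exact Or.inl ⟨f, hf, h⟩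
    · refine Or.inr ?_
      rw [Set.mem_ofPred_eq]
      rw [Finset.sum_sub_distrib, Finset.sum_const, Nat.card_Ioc, nsmul_eq_mul, Nat.sub_zero]
      linarith
  have hle := (measure_mono (μ := P) huniv).trans
    ((measure_union_le _ _).trans (add_le_add hbad' hdev))
  have he : Real.exp (-1) < 1 / 2 := by
    rw [Real.exp_neg, ← one_div]
    exact one_div_lt_one_div_of_lt (by norm_num) (by linarith [Real.exp_one_gt_d9])
  have hδ0 : 0 ≤ δ := by
    by_contra! h
    have h1 : (0 : ℝ) < (2 * (n : ℝ) ^ 2 + 1) ^ (2 * d) := by positivity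
    have h2 : (0 : ℝ) < 2 ^ L := by positivity
    nlinarith
  rw [measure_univ, ← ENNReal.ofReal_add (by linarith) (Real.exp_pos _).le,
    ENNReal.one_le_ofReal] at hle
  linarith

variable {F : Set (X → ℝ)} {oracle : List (X × Bool) → X → ℝ} {γ C : ℝ} {M : ℕ} {fstar : X → ℝ}

lemma measurableSet_region_epochOf [Nonempty X] (hmeas : MeasurableBounds F oracle) (hC : 0 ≤ C)
    {t : ℕ} (h0 : 0 < t) (ht : t ≤ tau M) :
    MeasurableSet {p : (ℕ → X × Bool) × X | p.2 ∈ region F oracle γ M C p.1 (epochOf t)} :=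
  measurableSet_region hmeas hC
    (tau_strictMono.lt_iff_lt.1 ((tau_epochOf_lt h0).trans_le ht)).le

open scoped Classical in
-- Markov's inequality at level `c` for the exponents `sqDist / 8 - loss / 2`; multiplying by `2`
-- gives the slope `1 / 4` and the slack `2 * c`.
lemma measure_loss_le (hZ : ∀ t, Measurable (Z t)) (hD : ∀ t, P.map (Z t) = D)
    (hind : iIndepFun Z P) (hmeas : MeasurableBounds F oracle) (hC : 0 ≤ C)
    (hfs : Realizes D fstar) (hs : Measurable fstar) (hs1 : ∀ x, fstar x ∈ Set.Icc (0 : ℝ) 1)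
    {f : X → ℝ} (hf : Measurable f) (hf1 : ∀ x, f x ∈ Set.Icc (0 : ℝ) 1) (a : ℕ) {b : ℕ}
    (hb : b ≤ tau M) (c : ℝ) :
    P {ω | ∑ t ∈ Finset.Ioc a b, (if (Z t ω).1 ∈ region F oracle γ M C (fun s => Z s ω) (epochOf t)
        then lossDiff f fstar (Z t ω) else 0) ≤
      (∑ t ∈ Finset.Ioc a b,
        sqDist D.fst f fstar (region F oracle γ M C (fun s => Z s ω) (epochOf t))) / 4 - 2 * c} ≤
      ENNReal.ofReal (Real.exp (-c)) := by
  have : Nonempty X := (nonempty_of_isProbabilityMeasure D.fst)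
  have hreg : ∀ t ∈ Finset.Ioc a b, MeasurableSet {p : (ℕ → X × Bool) × X |
      p.2 ∈ region F oracle γ M C p.1 (epochOf t)} := fun t ht =>
    measurableSet_region_epochOf hmeas hC (by have := Finset.mem_Ioc.1 ht; omega)
      ((Finset.mem_Ioc.1 ht).2.trans hb)
  have h := measure_sum_Ioc_ge_le hZ hD hind (a := a) (b := b)
    (φ := fun t z w => sqDist D.fst f fstar (region F oracle γ M C z (epochOf t)) / 8 -
      (if w.1 ∈ region F oracle γ M C z (epochOf t) then lossDiff f fstar w else 0) / 2)
    (fun t ht => ?_) (fun t ht z z' hz => ?_) (fun t ht z => ?_) c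
  · refine (measure_mono fun ω hω => ?_).trans h
    rw [Set.mem_ofPred_eq] at hω ⊢
    rw [Finset.sum_sub_distrib, ← Finset.sum_div, ← Finset.sum_div]
    linarith
  · refine Measurable.sub ?_ (Measurable.div_const (Measurable.ite ?_ ?_ measurable_const) 2)
    · exact ((measurable_sqDist (q := fun z => region F oracle γ M C z (epochOf t)) hf hs
        (hreg t ht)).comp measurable_fst).div_const 8
    · exact (measurable_fst.prodMk (measurable_fst.comp measurable_snd)) (hreg t ht)
    · exact (measurable_lossDiff hf hs).comp measurable_snd
  · have := region_epochOf_congr F oracle γ M C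
      (by have := Finset.mem_Ioc.1 ht; omega) hz
    simp only [this]
  · exact lintegral_exp_loss_le_one hfs hs hs1 hf hf1 (measurable_prodMk_left (hreg t ht))

open scoped Classical in
lemma measure_count_le (hZ : ∀ t, Measurable (Z t)) (hD : ∀ t, P.map (Z t) = D)
    (hind : iIndepFun Z P) (hmeas : MeasurableBounds F oracle) (hC : 0 ≤ C) (a : ℕ) {b : ℕ}
    (hb : b ≤ tau M) (c : ℝ) :
    P {ω | 2 * (∑ t ∈ Finset.Ioc a b,
        D.fst.real (region F oracle γ M C (fun s => Z s ω) (epochOf t))) + c ≤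
      ∑ t ∈ Finset.Ioc a b, (if (Z t ω).1 ∈ region F oracle γ M C (fun s => Z s ω) (epochOf t)
        then 1 else 0 : ℝ)} ≤ ENNReal.ofReal (Real.exp (-c)) := by
  have : Nonempty X := (nonempty_of_isProbabilityMeasure D.fst)
  have hreg : ∀ t ∈ Finset.Ioc a b, MeasurableSet {p : (ℕ → X × Bool) × X |
      p.2 ∈ region F oracle γ M C p.1 (epochOf t)} := fun t ht =>
    measurableSet_region_epochOf hmeas hC (by have := Finset.mem_Ioc.1 ht; omega)
      ((Finset.mem_Ioc.1 ht).2.trans hb)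
  have h := measure_sum_Ioc_ge_le hZ hD hind (a := a) (b := b)
    (φ := fun t z w => (if w.1 ∈ region F oracle γ M C z (epochOf t) then 1 else 0) -
      2 * D.fst.real (region F oracle γ M C z (epochOf t)))
    (fun t ht => ?_) (fun t ht z z' hz => ?_) (fun t ht z => ?_) c
  · refine (measure_mono fun ω hω => ?_).trans h
    rw [Set.mem_ofPred_eq] at hω ⊢
    rw [Finset.sum_sub_distrib, ← Finset.mul_sum]
    linarith
  · refine Measurable.sub (Measurable.ite ?_ measurable_const measurable_const)
      (Measurable.const_mul ?_ 2)
    · exact (measurable_fst.prodMk (measurable_fst.comp measurable_snd)) (hreg t ht)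
    · exact ((measurable_measure_prodMk_left (ν := D.fst) (hreg t ht)).ennreal_toReal).comp
        measurable_fst
  · have := region_epochOf_congr F oracle γ M C
      (by have := Finset.mem_Ioc.1 ht; omega) hz
    simp only [this]
  · have hq : MeasurableSet (region F oracle γ M C z (epochOf t)) :=
      measurable_prodMk_left (hreg t ht)
    have h := lintegral_exp_count_le_one (μ := D.fst) hq
    have hm : Measurable fun x => ENNReal.ofReal (Real.exp
        ((if x ∈ region F oracle γ M C z (epochOf t) then (1 : ℝ) else 0) -
          2 * D.fst.real (region F oracle γ M C z (epochOf t)))) :=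
      ((Measurable.ite hq measurable_const measurable_const).sub
        measurable_const).exp.ennreal_ofReal
    rwa [← lintegral_map hm measurable_fst]

end Concentration

open scoped Classical in
/-- The excess loss of `f` on the labels queried at the times in `(a, b]`. -/
noncomputable def excessLoss {X : Type*} (F : Set (X → ℝ)) (oracle : List (X × Bool) → X → ℝ)
    (γ : ℝ) (M : ℕ) (C : ℝ) (fstar f : X → ℝ) (z : ℕ → X × Bool)
    (a b : ℕ) : ℝ :=
  ∑ t ∈ Finset.Ioc a b,
    if (z t).1 ∈ region F oracle γ M C z (epochOf t) then lossDiff f fstar (z t) else 0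

/-- The query regions belong to the run and not to the compared function, so exchanging `f'` for `f`
only changes the squared losses, each by at most twice the pointwise distance. -/
lemma excessLoss_ge_of_approx {X : Type*} (F : Set (X → ℝ))
    (oracle : List (X × Bool) → X → ℝ) (γ : ℝ) (M : ℕ) (C : ℝ) (fstar : X → ℝ) {f f' : X → ℝ}
    (hf1 : ∀ x, f x ∈ Set.Icc (0 : ℝ) 1)
    (hf1' : ∀ x, f' x ∈ Set.Icc (0 : ℝ) 1) (z : ℕ → X × Bool) (a : ℕ) {b n : ℕ} (hb : b ≤ n) :
    excessLoss F oracle γ M C fstar f' z a b -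
      2 * ∑ t ∈ Finset.Ioc 0 n, |f (z t).1 - f' (z t).1| ≤
      excessLoss F oracle γ M C fstar f z a b := by
  classical
  have h1 : ∑ t ∈ Finset.Ioc a b, |f (z t).1 - f' (z t).1| ≤
      ∑ t ∈ Finset.Ioc 0 n, |f (z t).1 - f' (z t).1| :=
    Finset.sum_le_sum_of_subset_of_nonneg
      (Finset.Ioc_subset_Ioc (Nat.zero_le _) hb) fun _ _ _ => abs_nonneg _
  refine le_trans (sub_le_sub_left (mul_le_mul_of_nonneg_left h1 zero_le_two) _) ?_
  rw [excessLoss, excessLoss, Finset.mul_sum, ← Finset.sum_sub_distrib]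
  refine Finset.sum_le_sum fun t _ => ?_
  split_ifs
  · have := (abs_le.1 (abs_sq_sub_sq_le (hf1 (z t).1) (hf1' (z t).1) (labelVal_mem (z t).2))).1
    rw [lossDiff, lossDiff]
    linarith
  · linarith [abs_nonneg (f (z t).1 - f' (z t).1)]

/-! ### Uniformity over the class: finite net, then pointwise limits. -/

section Uniform

variable {X Ω : Type*} [MeasurableSpace X] [MeasurableSpace Ω] {P : Measure Ω}
  [IsProbabilityMeasure P] {D : Measure (X × Bool)} [IsProbabilityMeasure D]
  {Z : ℕ → Ω → X × Bool} {F : Set (X → ℝ)} {oracle : List (X × Bool) → X → ℝ} {γ : ℝ} {M : ℕ}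
  {C : ℝ} {fstar : X → ℝ}

variable (F oracle γ M C fstar) in
/-- The sum of the squared distances of `f` to `fstar` on the query regions at the times in
`(a, b]`. -/
noncomputable def sumSqDist (μ : Measure X) (f : X → ℝ) (z : ℕ → X × Bool) (a b : ℕ) : ℝ :=
  ∑ t ∈ Finset.Ioc a b, sqDist μ f fstar (region F oracle γ M C z (epochOf t))

lemma measurableSet_region_of_seq [Nonempty X] (hmeas : MeasurableBounds F oracle) (hC : 0 ≤ C)
    (z : ℕ → X × Bool) {a b : ℕ} (hb : b ≤ tau M) {t : ℕ} (ht : t ∈ Finset.Ioc a b) :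
    MeasurableSet (region F oracle γ M C z (epochOf t)) :=
  measurable_prodMk_left (measurableSet_region_epochOf hmeas hC
    (by have := Finset.mem_Ioc.1 ht; omega) ((Finset.mem_Ioc.1 ht).2.trans hb))

lemma sumSqDist_le_of_approx [Nonempty X] (hmeas : MeasurableBounds F oracle) (hC : 0 ≤ C)
    {f f' : X → ℝ} (hf : Measurable f) (hf1 : ∀ x, f x ∈ Set.Icc (0 : ℝ) 1) (hf' : Measurable f')
    (hf1' : ∀ x, f' x ∈ Set.Icc (0 : ℝ) 1) (hs : Measurable fstar)
    (hs1 : ∀ x, fstar x ∈ Set.Icc (0 : ℝ) 1) (z : ℕ → X × Bool) (a : ℕ) {b n : ℕ} (hb : b ≤ n)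
    (hn : n ≤ tau M) :
    sumSqDist F oracle γ M C fstar D.fst f z a b ≤ sumSqDist F oracle γ M C fstar D.fst f' z a b +
      2 * (n * ∫ x, |f x - f' x| ∂D.fst) := by
  set I := ∫ x, |f x - f' x| ∂D.fst with hI
  have hI0 : 0 ≤ I := integral_nonneg fun _ => abs_nonneg _
  calc _ ≤ ∑ t ∈ Finset.Ioc a b,
        (sqDist D.fst f' fstar (region F oracle γ M C z (epochOf t)) + 2 * I) :=
        Finset.sum_le_sum fun t ht => sqDist_le_add hf hf1 hf' hf1' hs hs1
          (measurableSet_region_of_seq hmeas hC z (hb.trans hn) ht)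
    _ = sumSqDist F oracle γ M C fstar D.fst f' z a b + (b - a : ℕ) * (2 * I) := by
        rw [Finset.sum_add_distrib, Finset.sum_const, Nat.card_Ioc, nsmul_eq_mul, sumSqDist]
    _ ≤ _ := by
        have : ((b - a : ℕ) : ℝ) ≤ n := by exact_mod_cast (Nat.sub_le b a).trans hb
        nlinarith

/-- Along a fixed run, both sides are continuous under pointwise convergence, the squared distances
by dominated convergence. This passes from the countable subclass to `F`. -/
lemma excessLoss_ge_of_tendsto [Nonempty X] (hmeas : MeasurableBounds F oracle) (hC : 0 ≤ C)
    {u : ℕ → X → ℝ} {f : X → ℝ} (hu : ∀ n, Measurable (u n))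
    (hu1 : ∀ n x, u n x ∈ Set.Icc (0 : ℝ) 1) (hs : Measurable fstar)
    (hs1 : ∀ x, fstar x ∈ Set.Icc (0 : ℝ) 1) (h : ∀ x, Tendsto (fun n => u n x) atTop (𝓝 (f x)))
    (z : ℕ → X × Bool) (a : ℕ) {b : ℕ} (hb : b ≤ tau M) {K : ℝ}
    (hK : ∀ n, sumSqDist F oracle γ M C fstar D.fst (u n) z a b / 4 - K ≤
      excessLoss F oracle γ M C fstar (u n) z a b) :
    sumSqDist F oracle γ M C fstar D.fst f z a b / 4 - K ≤
      excessLoss F oracle γ M C fstar f z a b := by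
  classical
  have h1 : Tendsto (fun n => sumSqDist F oracle γ M C fstar D.fst (u n) z a b) atTop
      (𝓝 (sumSqDist F oracle γ M C fstar D.fst f z a b)) :=
    tendsto_finsetSum _ fun t ht =>
      tendsto_sqDist hu hu1 hs hs1 (measurableSet_region_of_seq hmeas hC z hb ht) h
  have h2 : Tendsto (fun n => excessLoss F oracle γ M C fstar (u n) z a b) atTop
      (𝓝 (excessLoss F oracle γ M C fstar f z a b)) := by
    refine tendsto_finsetSum _ fun t _ => ?_
    by_cases ht : (z t).1 ∈ region F oracle γ M C z (epochOf t)
    · simp only [ht, if_true, lossDiff]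
      exact (((h _).sub_const _).pow 2).sub_const _
    · simp only [ht, if_false]
      exact tendsto_const_nhds
  exact le_of_tendsto_of_tendsto' ((h1.div_const 4).sub_const K) h2 hK

/-- Uniform lower bound of the excess losses by the squared distances to the regression
function. -/
lemma measure_uniform_loss_le (hZ : ∀ t, Measurable (Z t)) (hD : ∀ t, P.map (Z t) = D)
    (hind : iIndepFun Z P) (hmeas : MeasurableBounds F oracle) (hC : 0 ≤ C)
    (hF : ∀ f ∈ F, Measurable f ∧ ∀ x, f x ∈ Set.Icc (0 : ℝ) 1) (hsep : PointwiseSeparable F)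
    (hfF : fstar ∈ F) (hfs : Realizes D fstar) {d : ℕ} (hd : pdim F ≤ d) {n : ℕ} (hn : 0 < n)
    (hnM : n ≤ tau M) {L : ℕ} {δ c : ℝ} (hδ0 : 0 ≤ δ) (hδ : δ ≤ 1)
    (hL : (2 * (n : ℝ) ^ 2 + 1) ^ (2 * d) ≤ δ / 2 * 2 ^ L)
    (hc : (2 * (n : ℝ) ^ 2 + 1) ^ d * (n + 1) ^ 2 * Real.exp (-c) ≤ δ / 2) :
    P {ω | ¬ ∀ f ∈ F, ∀ a ≤ n, ∀ b ≤ n,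
      sumSqDist F oracle γ M C fstar D.fst f (fun s => Z s ω) a b / 4 - (3 * L + 2 * c + 4) ≤
        excessLoss F oracle γ M C fstar f (fun s => Z s ω) a b} ≤ ENNReal.ofReal δ := by
  classical
  have : Nonempty X := (nonempty_of_isProbabilityMeasure D.fst)
  obtain ⟨hs, hs1⟩ := hF fstar hfF
  obtain ⟨F₀, hF₀, hcount, happ⟩ := hsep
  obtain ⟨r, N, hN, hNF, hr, hbad, hdist⟩ := exists_net_sample hZ hD hind hcount
    (fun f hf => hF f (hF₀ hf)) ((pdim_mono hF₀).trans hd) hn hδ hL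
  set B₁ := {ω | ∃ f ∈ F₀, (L : ℝ) + 1 <
    ∑ t ∈ Finset.Ioc 0 n, |f (Z t ω).1 - r f (Z t ω).1|} with hB₁
  -- The union bound runs over the net and over all windows, since nesting of the active sets uses
  -- increments of the loss as well as its totals.
  let I := N ×ˢ (Finset.range (n + 1) ×ˢ Finset.range (n + 1))
  let B₂ : (X → ℝ) × ℕ × ℕ → Set Ω := fun i =>
    {ω | excessLoss F oracle γ M C fstar i.1 (fun s => Z s ω) i.2.1 i.2.2 ≤
      sumSqDist F oracle γ M C fstar D.fst i.1 (fun s => Z s ω) i.2.1 i.2.2 / 4 - 2 * c}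
  have hB₂ : P (⋃ i ∈ I, B₂ i) ≤ ENNReal.ofReal (δ / 2) := by
    calc P (⋃ i ∈ I, B₂ i) ≤ ∑ i ∈ I, P (B₂ i) := measure_biUnion_finset_le _ _
      _ ≤ ∑ i ∈ I, ENNReal.ofReal (Real.exp (-c)) := by
          refine Finset.sum_le_sum fun i hi => ?_
          obtain ⟨h1, h2⟩ := Finset.mem_product.1 hi
          have hb := Finset.mem_range.1 (Finset.mem_product.1 h2).2
          obtain ⟨hm, hm1⟩ := hF _ (hF₀ (hNF _ h1))
          exact measure_loss_le hZ hD hind hmeas hC hfs hs hs1 hm hm1 _ (by omega) c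
      _ = ENNReal.ofReal (I.card * Real.exp (-c)) := by
          rw [Finset.sum_const, nsmul_eq_mul, ENNReal.ofReal_mul (by positivity),
            ENNReal.ofReal_natCast]
      _ ≤ _ := by
          refine ENNReal.ofReal_le_ofReal (le_trans ?_ hc)
          refine mul_le_mul_of_nonneg_right ?_ (Real.exp_pos _).le
          have h1 : I.card ≤ (2 * n ^ 2 + 1) ^ d * (n + 1) ^ 2 := by
            simp only [I, Finset.card_product, Finset.card_range]
            calc _ ≤ (2 * n ^ 2 + 1) ^ d * ((n + 1) * (n + 1)) := Nat.mul_le_mul_right _ hN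
              _ = _ := by ring
          exact_mod_cast h1
  have hsub : {ω | ¬ ∀ f ∈ F, ∀ a ≤ n, ∀ b ≤ n,
      sumSqDist F oracle γ M C fstar D.fst f (fun s => Z s ω) a b / 4 - (3 * L + 2 * c + 4) ≤
        excessLoss F oracle γ M C fstar f (fun s => Z s ω) a b} ⊆ B₁ ∪ ⋃ i ∈ I, B₂ i := by
    intro ω hω
    by_contra hnot
    rw [Set.mem_ofPred_eq] at hω
    refine hω fun f hf a ha b hb => ?_
    have h0 : ∀ g ∈ F₀, sumSqDist F oracle γ M C fstar D.fst g (fun s => Z s ω) a b / 4 -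
        (3 * L + 2 * c + 4) ≤ excessLoss F oracle γ M C fstar g (fun s => Z s ω) a b := by
      intro g hg
      have hrg := hF₀ (hNF _ (hr g hg))
      have h1 : ∑ t ∈ Finset.Ioc 0 n, |g (Z t ω).1 - r g (Z t ω).1| ≤ L + 1 := by
        by_contra! h
        exact hnot (Or.inl ⟨g, hg, h⟩)
      have h2 : sumSqDist F oracle γ M C fstar D.fst (r g) (fun s => Z s ω) a b / 4 - 2 * c <
          excessLoss F oracle γ M C fstar (r g) (fun s => Z s ω) a b := by
        by_contra! h
        refine hnot (Or.inr (Set.mem_biUnion (x := (r g, a, b)) ?_ h))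
        exact Finset.mem_product.2 ⟨hr g hg, Finset.mem_product.2
          ⟨Finset.mem_range.2 (Nat.lt_succ_of_le ha), Finset.mem_range.2 (Nat.lt_succ_of_le hb)⟩⟩
      have h3 := excessLoss_ge_of_approx F oracle γ M C fstar (hF g (hF₀ hg)).2 (hF _ hrg).2
        (fun s => Z s ω) a hb
      have h4 := sumSqDist_le_of_approx (D := D) (γ := γ) hmeas hC (hF g (hF₀ hg)).1
        (hF g (hF₀ hg)).2 (hF _ hrg).1 (hF _ hrg).2 hs hs1 (fun s => Z s ω) a hb hnM
      have h5 := hdist g hg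
      -- Passing to the representative costs `2 (L + 1)` in the loss and `2 (2 L + 4) / 4` in the
      -- distances. Together with `2 c` this is `3 L + 2 c + 4`.
      linarith
    obtain ⟨u, hu, hlim⟩ := happ f hf
    exact excessLoss_ge_of_tendsto hmeas hC (fun k => (hF _ (hF₀ (hu k))).1)
      (fun k => (hF _ (hF₀ (hu k))).2) hs hs1 hlim _ a (hb.trans hnM) fun k => h0 _ (hu k)
  calc _ ≤ _ := measure_mono hsub
    _ ≤ _ := measure_union_le _ _
    _ ≤ _ := add_le_add hbad hB₂
    _ = ENNReal.ofReal δ := by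
        rw [← ENNReal.ofReal_add (by linarith) (by linarith)]
        congr 1
        ring

end Uniform

/-! ### Disagreement -/

lemma one_le_valDisagreement {X : Type*} [MeasurableSpace X] (F : Set (X → ℝ)) (f : X → ℝ)
    (γ ε : ℝ) : 1 ≤ valDisagreement F f γ ε := le_sup_right

lemma one_le_theta {X : Type*} [MeasurableSpace X] {F : Set (X → ℝ)} {f : X → ℝ} (hf : f ∈ F)
    (γ : ℝ) : 1 ≤ theta F γ :=
  (one_le_valDisagreement F f (γ / 2) 1).trans
    (le_iSup₂_of_le f hf (le_iSup₂_of_le (1 : ℝ) one_pos le_rfl))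

lemma mul_measure_le_theta {X : Type*} [MeasurableSpace X] {F : Set (X → ℝ)} {f₀ : X → ℝ}
    (hf : f₀ ∈ F) {γ γ' ε : ℝ} (hγ : γ / 2 < γ') (hε : 0 < ε) (μ : Measure X)
    [hμ : IsProbabilityMeasure μ] :
    ENNReal.ofReal (γ' ^ 2 / ε ^ 2) *
      μ {x | ∃ f ∈ F, γ' < |f x - f₀ x| ∧ l2norm μ (fun x' => f x' - f₀ x') ≤ ε} ≤ theta F γ := by
  have h : ENNReal.ofReal (γ' ^ 2 / ε ^ 2) *
      μ {x | ∃ f ∈ F, γ' < |f x - f₀ x| ∧ l2norm μ (fun x' => f x' - f₀ x') ≤ ε} ≤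
      valDisagreement F f₀ (γ / 2) (ε / 2) := by
    refine le_trans ?_ le_sup_left
    exact le_iSup₂_of_le μ hμ (le_iSup₂_of_le γ' hγ
      (le_iSup₂_of_le ε (by linarith : ε / 2 < ε) le_rfl))
  exact h.trans (le_iSup₂_of_le f₀ hf (le_iSup₂_of_le (ε / 2) (by positivity) le_rfl))

/-- A region on which members of `G` that are close to `f₀` in `L²` disagree with `f₀` is small. -/
lemma measureReal_le_theta {X : Type*} [MeasurableSpace X] {F G : Set (X → ℝ)} {f₀ : X → ℝ}
    (hf₀ : f₀ ∈ F) (hG : G ⊆ F) {γ : ℝ} (hγ : 0 < γ) (hθ : theta F γ ≠ ⊤) (μ : Measure X)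
    [IsProbabilityMeasure μ] {q : Set X} (hq : MeasurableSet q) {V : ℝ} (hV : 0 < V)
    (hGV : ∀ f ∈ G, sqDist μ f f₀ q ≤ V) (hqG : ∀ x ∈ q, ∃ f ∈ G, γ / 2 < |f x - f₀ x|) :
    μ.real q ≤ 4 * (theta F γ).toReal * V / γ ^ 2 := by
  set p := μ.real q with hp
  rcases (measureReal_nonneg : 0 ≤ μ.real q).eq_or_lt with h0 | hp0
  · rw [hp, ← h0]; positivity
  have hq0 : μ q ≠ 0 := fun h => by
    rw [measureReal_def, h] at hp0
    simp at hp0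
  -- The coefficient is a supremum over all distributions, so it may be used for `μ` conditioned on
  -- `q`. There the squared norms are at most `V / p`, while the disagreement set has full mass.
  set ν := ProbabilityTheory.cond μ q with hν
  have hνp : IsProbabilityMeasure ν := cond_isProbabilityMeasure hq0
  set ε := Real.sqrt (V / p) with hε
  have hε0 : 0 < ε := Real.sqrt_pos.2 (by positivity)
  have hε2 : ε ^ 2 = V / p := Real.sq_sqrt (by positivity)
  have hnorm : ∀ f ∈ G, l2norm ν (fun x => f x - f₀ x) ≤ ε := by
    intro f hf
    refine Real.sqrt_le_sqrt ?_
    rw [hν, ProbabilityTheory.cond, integral_smul_measure, ← integral_indicator hq,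
      ENNReal.toReal_inv, smul_eq_mul, inv_mul_eq_div]
    exact div_le_div_of_nonneg_right (hGV f hf) hp0.le
  -- The coefficient requires levels strictly above `γ / 2`; these levels decrease to it, and the
  -- sets `A k` exhaust `q`. Continuity from below needs no measurability of `A k`.
  let g : ℕ → ℝ := fun k => γ / 2 + 1 / ((k : ℝ) + 1)
  let A : ℕ → Set X := fun k => {x | x ∈ q ∧ ∃ f ∈ G, g k < |f x - f₀ x|}
  have hA : ∀ k, ENNReal.ofReal ((γ / 2) ^ 2 / ε ^ 2) * ν (A k) ≤ theta F γ := by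
    intro k
    have hk : (0 : ℝ) < 1 / ((k : ℝ) + 1) := by positivity
    have hgk : γ / 2 < g k := by simp only [g]; linarith
    refine le_trans (mul_le_mul' (ENNReal.ofReal_le_ofReal ?_) (measure_mono ?_))
      (mul_measure_le_theta hf₀ hgk hε0 ν)
    · gcongr
    · rintro x ⟨-, f, hf, hx⟩
      exact ⟨f, hG hf, hx, hnorm f hf⟩
  have hAmono : Monotone A := by
    rintro i j hij x ⟨hx, f, hf, hlt⟩
    refine ⟨hx, f, hf, lt_of_le_of_lt ?_ hlt⟩
    simp only [g]
    gcongr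
  have hAU : ⋃ k, A k = q := by
    refine Set.Subset.antisymm (Set.iUnion_subset fun k x hx => hx.1) fun x hx => ?_
    obtain ⟨f, hf, hlt⟩ := hqG x hx
    obtain ⟨k, hk⟩ := exists_nat_one_div_lt (sub_pos.2 hlt)
    exact Set.mem_iUnion.2 ⟨k, hx, f, hf, by simp only [g]; linarith⟩
  have hνq : ν q = 1 := by
    rw [hν, cond_apply hq, Set.inter_self, ENNReal.inv_mul_cancel hq0 (measure_ne_top _ _)]
  have h1 : ENNReal.ofReal ((γ / 2) ^ 2 / ε ^ 2) ≤ theta F γ := by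
    rw [← mul_one (ENNReal.ofReal _), ← hνq, ← hAU, hAmono.measure_iUnion, ENNReal.mul_iSup]
    exact iSup_le hA
  have h2 := (ENNReal.ofReal_le_iff_le_toReal hθ).1 h1
  rw [hε2, div_div_eq_mul_div, div_le_iff₀ hV] at h2
  rw [le_div_iff₀ (by positivity)]
  nlinarith

/-! ### Confidence bounds -/

section Bounds

variable {X : Type*} {F G G' : Set (X → ℝ)} {x : X} {γ : ℝ}

lemma bddBelow_eval (hF : ∀ f ∈ F, ∀ x, f x ∈ Set.Icc (0 : ℝ) 1) (hG : G ⊆ F) :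
    BddBelow ((fun f : X → ℝ => f x) '' G) := by
  refine ⟨0, ?_⟩
  rintro _ ⟨f, hf, rfl⟩
  exact (hF f (hG hf) x).1

lemma bddAbove_eval (hF : ∀ f ∈ F, ∀ x, f x ∈ Set.Icc (0 : ℝ) 1) (hG : G ⊆ F) :
    BddAbove ((fun f : X → ℝ => f x) '' G) := by
  refine ⟨1, ?_⟩
  rintro _ ⟨f, hf, rfl⟩
  exact (hF f (hG hf) x).2

lemma lcb_le (hF : ∀ f ∈ F, ∀ x, f x ∈ Set.Icc (0 : ℝ) 1) (hG : G ⊆ F) {f : X → ℝ} (hf : f ∈ G) :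
    lcb G x ≤ f x :=
  csInf_le (bddBelow_eval hF hG) ⟨f, hf, rfl⟩

lemma le_ucb (hF : ∀ f ∈ F, ∀ x, f x ∈ Set.Icc (0 : ℝ) 1) (hG : G ⊆ F) {f : X → ℝ} (hf : f ∈ G) :
    f x ≤ ucb G x :=
  le_csSup (bddAbove_eval hF hG) ⟨f, hf, rfl⟩

/-- A larger active set only widens the confidence interval. Nonemptiness of `G'` excludes the
default values of `sInf` and `sSup`. -/
lemma Queries.mono (hF : ∀ f ∈ F, ∀ x, f x ∈ Set.Icc (0 : ℝ) 1) (hG : G ⊆ F) (h : G' ⊆ G)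
    (hne : G'.Nonempty) {f f' : X → ℝ} (hq : Queries G' f' γ x) : Queries G f γ x := by
  rw [queries_iff] at hq ⊢
  have h1 : lcb G x ≤ lcb G' x :=
    csInf_le_csInf (bddBelow_eval hF hG) (hne.image _) (Set.image_mono h)
  have h2 : ucb G' x ≤ ucb G x :=
    csSup_le_csSup (bddAbove_eval hF hG) (hne.image _) (Set.image_mono h)
  refine ⟨⟨h1.trans_lt hq.1.1, hq.1.2.trans_le h2⟩, fun h3 => hq.2 ⟨h3.1.trans h1, h2.trans h3.2⟩⟩

/-- If all of `G` were within `γ / 2` of `f₀ x`, the confidence interval would have length at most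
`γ`. As it contains `1 / 2`, it would lie in the abstention band. -/
lemma Queries.exists_far (hne : G.Nonempty) {f f₀ : X → ℝ} (hq : Queries G f γ x) :
    ∃ g ∈ G, γ / 2 < |g x - f₀ x| := by
  by_contra! h
  obtain ⟨⟨h1, h2⟩, h3⟩ := queries_iff.1 hq
  have hu : ucb G x ≤ f₀ x + γ / 2 := by
    refine csSup_le (hne.image _) ?_
    rintro _ ⟨g, hg, rfl⟩
    linarith [(abs_le.1 (h g hg)).2]
  have hl : f₀ x - γ / 2 ≤ lcb G x := by
    refine le_csInf (hne.image _) ?_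
    rintro _ ⟨g, hg, rfl⟩
    linarith [(abs_le.1 (h g hg)).1]
  exact h3 ⟨by linarith, by linarith⟩

/-! ### Excess error -/

open scoped Classical in
/-- The excess loss of the prediction `o` on the label `y`, relative to the prediction `b`. -/
noncomputable def predLoss (γ : ℝ) (o : Option Bool) (b y : Bool) : ℝ :=
  (if o ≠ some y ∧ o ≠ none then 1 else 0) + (1 / 2 - γ) * (if o = none then 1 else 0) -
    (if b ≠ y then 1 else 0)

/-- Where the rule abstains, `f₀` lies in the band and the Bayes error is at least `1 / 2 - γ`. A
prediction that differs from Bayes costs `|2 f₀ - 1|`. Either this vanishes or `1 / 2` is interior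
to the interval, so that `x` is queried, and it is at most `2 |f - f₀|` because `f` and `f₀` are on
opposite sides of `1 / 2`. -/
lemma predLoss_le (hF : ∀ f ∈ F, ∀ x, f x ∈ Set.Icc (0 : ℝ) 1) (hG : G ⊆ F) {f f₀ : X → ℝ}
    (hf : f ∈ G) (hf₀ : f₀ ∈ G) :
    f₀ x * predLoss γ (epochClassifier G f γ x) (inducedClassifier f₀ x) true +
      (1 - f₀ x) * predLoss γ (epochClassifier G f γ x) (inducedClassifier f₀ x) false ≤
    {x | Queries G f γ x}.indicator (fun x => 2 * |f x - f₀ x|) x := by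
  have hl := lcb_le (x := x) hF hG hf
  have hl₀ := lcb_le (x := x) hF hG hf₀
  have hu := le_ucb (x := x) hF hG hf
  have hu₀ := le_ucb (x := x) hF hG hf₀
  have hnn : 0 ≤ {x | Queries G f γ x}.indicator (fun x => 2 * |f x - f₀ x|) x :=
    Set.indicator_nonneg (fun x _ => by positivity) x
  have hquery : lcb G x < 1 / 2 → 1 / 2 < ucb G x → epochClassifier G f γ x ≠ none →
      {x | Queries G f γ x}.indicator (fun x => 2 * |f x - f₀ x|) x = 2 * |f x - f₀ x| :=
    fun h1 h2 h3 => Set.indicator_of_mem (show x ∈ {x | Queries G f γ x} from ⟨⟨h1, h2⟩, h3⟩) _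
  have ha := le_abs_self (f x - f₀ x)
  have hb := neg_le_abs (f x - f₀ x)
  by_cases hband : Set.Icc (lcb G x) (ucb G x) ⊆ Set.Icc (1 / 2 - γ) (1 / 2 + γ)
  · obtain ⟨h1, h2⟩ := hband ⟨hl₀, hu₀⟩
    have e : epochClassifier G f γ x = none := epochClassifier_eq_none_iff.2 hband
    refine le_trans ?_ hnn
    rw [e]
    by_cases h : 1 / 2 ≤ f₀ x
    · have e' : inducedClassifier f₀ x = true := by simp only [inducedClassifier, h, decide_true]
      simp [predLoss, e']
      nlinarith
    · have e' : inducedClassifier f₀ x = false := by simp only [inducedClassifier, h, decide_false]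
      simp [predLoss, e']
      nlinarith
  have hnone : epochClassifier G f γ x ≠ none := fun h => hband (epochClassifier_eq_none_iff.1 h)
  have key : ∀ b, epochClassifier G f γ x = some b →
      f₀ x * predLoss γ (some b) (inducedClassifier f₀ x) true +
        (1 - f₀ x) * predLoss γ (some b) (inducedClassifier f₀ x) false =
        if b = inducedClassifier f₀ x then 0 else if b then 1 - 2 * f₀ x else 2 * f₀ x - 1 := by
    intro b _
    cases b <;> cases inducedClassifier f₀ x <;> simp [predLoss] <;> ring
  have hcase : (1 / 2 ≤ f x ∧ ¬ (f x ≤ 1 / 2 ∧ ucb G x ≤ 1 / 2) ∧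
      epochClassifier G f γ x = some true) ∨ ((f x < 1 / 2 ∨ f x ≤ 1 / 2 ∧ ucb G x ≤ 1 / 2) ∧
      epochClassifier G f γ x = some false) := by
    unfold epochClassifier
    rw [if_neg hband]
    split_ifs with h1 h2 h3
    · exact Or.inl ⟨h1.le, fun h => absurd h.1 (not_le.2 h1), rfl⟩
    · exact Or.inr ⟨Or.inl h2, rfl⟩
    · exact Or.inr ⟨Or.inr ⟨not_lt.1 h1, h3⟩, rfl⟩
    · exact Or.inl ⟨not_lt.1 h2, fun h => h3 h.2, rfl⟩
  by_cases h : 1 / 2 ≤ f₀ x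
  · have e' : inducedClassifier f₀ x = true := by simp only [inducedClassifier, h, decide_true]
    rcases hcase with ⟨_, _, e⟩ | ⟨h1, e⟩
    · rw [e, key true e, e']
      simpa using hnn
    · rw [e, key false e, e']
      simp only [Bool.false_eq_true, if_false]
      -- If `ucb ≤ 1 / 2`, then `f₀ x = 1 / 2` and disagreement with the Bayes label is free.
      -- Otherwise the tie case is impossible and `x` is queried.
      by_cases hu1 : ucb G x ≤ 1 / 2
      · linarith
      have h2 : f x < 1 / 2 := h1.resolve_right fun h => hu1 h.2
      rw [hquery (hl.trans_lt h2) (not_le.1 hu1) hnone]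
      linarith
  · have e' : inducedClassifier f₀ x = false := by simp only [inducedClassifier, h, decide_false]
    rcases hcase with ⟨h1, h2, e⟩ | ⟨_, e⟩
    · rw [e, key true e, e']
      simp only [Bool.true_eq_false, if_false, if_true]
      -- The tie rule is needed here: without it, `f x = ucb = 1 / 2` could yield `+1` at an
      -- unqueried point with `f₀ x < 1 / 2`.
      have hu1 : 1 / 2 < ucb G x := by
        by_contra! hle
        exact h2 ⟨hu.trans hle, hle⟩
      rw [hquery (hl₀.trans_lt (not_le.1 h)) hu1 hnone]
      linarith
    · rw [e, key false e, e']
      simpa using hnn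

end Bounds

lemma measurableSet_pred {X : Type*} [MeasurableSpace X] {h : X → Option Bool}
    (hh : ∀ o, MeasurableSet {x | h x = o}) (R : Option Bool → Bool → Prop) :
    MeasurableSet {z : X × Bool | R (h z.1) z.2} := by
  have : {z : X × Bool | R (h z.1) z.2} = ⋃ o, ⋃ b, ⋃ _ : R o b,
      {z : X × Bool | h z.1 = o} ∩ {z : X × Bool | z.2 = b} := by
    ext z
    simp only [Set.mem_iUnion, Set.mem_inter_iff, Set.mem_ofPred_eq, exists_prop]
    constructor
    · exact fun hz => ⟨_, _, hz, rfl, rfl⟩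
    · rintro ⟨o, b, hR, rfl, rfl⟩
      exact hR
  rw [this]
  exact MeasurableSet.iUnion fun o => MeasurableSet.iUnion fun b => MeasurableSet.iUnion fun _ =>
    (measurable_fst (hh o)).inter (measurable_snd (measurableSet_singleton b))

lemma measurableSet_epochClassifier_eq {X : Type*} [MeasurableSpace X] {G : Set (X → ℝ)}
    {f : X → ℝ} {γ : ℝ} (hf : Measurable f) (hl : Measurable (lcb G)) (hu : Measurable (ucb G))
    (hlu : ∀ x, lcb G x ≤ ucb G x) (o : Option Bool) :
    MeasurableSet {x | epochClassifier G f γ x = o} := by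
  let _ : MeasurableSpace (Option Bool) := ⊤
  have hm : Measurable (epochClassifier G f γ) := by
    unfold epochClassifier
    refine Measurable.ite ?_ measurable_const (Measurable.ite (measurableSet_lt measurable_const hf)
      measurable_const (Measurable.ite (measurableSet_lt hf measurable_const) measurable_const
      (Measurable.ite (measurableSet_le hu measurable_const) measurable_const measurable_const)))
    simp only [fun x => Set.Icc_subset_Icc_iff (a₂ := 1 / 2 - γ) (b₂ := 1 / 2 + γ) (hlu x)]
    exact (measurableSet_le measurable_const hl).inter (measurableSet_le hu measurable_const)
  exact hm (t := {o}) trivial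

section Excess

variable {X : Type*} [MeasurableSpace X] {D : Measure (X × Bool)} [IsProbabilityMeasure D]
  {F G : Set (X → ℝ)} {fstar : X → ℝ} {γ : ℝ}

lemma chowExcess_eq_integral {h : X → Option Bool} (hh : ∀ o, MeasurableSet {x | h x = o})
    (hs : Measurable fstar) (hfs : Realizes D fstar) :
    chowExcess D γ fstar h = ∫ x, (fstar x * predLoss γ (h x) (inducedClassifier fstar x) true +
      (1 - fstar x) * predLoss γ (h x) (inducedClassifier fstar x) false) ∂D.fst ∧
    Integrable (fun x => fstar x * predLoss γ (h x) (inducedClassifier fstar x) true +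
      (1 - fstar x) * predLoss γ (h x) (inducedClassifier fstar x) false) D.fst := by
  let _ : MeasurableSpace (Option Bool) := ⊤
  have hhm : Measurable h := measurable_to_countable' fun o => hh o
  have hind : Measurable (inducedClassifier fstar) := by
    refine measurable_to_bool ?_
    have : inducedClassifier fstar ⁻¹' {true} = {x | 1 / 2 ≤ fstar x} := by
      ext x
      simp [inducedClassifier]
    rw [this]
    exact measurableSet_le measurable_const hs
  have hpm : Measurable fun w : Option Bool × Bool × Bool => predLoss γ w.1 w.2.1 w.2.2 :=
    Measurable.of_discrete
  obtain ⟨B, hB⟩ : ∃ B, ∀ w : Option Bool × Bool × Bool, |predLoss γ w.1 w.2.1 w.2.2| ≤ B := by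
    obtain ⟨B, hB⟩ := (Set.finite_range fun w : Option Bool × Bool × Bool =>
      |predLoss γ w.1 w.2.1 w.2.2|).bddAbove
    exact ⟨B, fun w => hB ⟨w, rfl⟩⟩
  have hφ : Measurable fun z : X × Bool => predLoss γ (h z.1) (inducedClassifier fstar z.1) z.2 :=
    hpm.comp ((hhm.comp measurable_fst).prodMk ((hind.comp measurable_fst).prodMk measurable_snd))
  have hφi : Integrable (fun z : X × Bool =>
      predLoss γ (h z.1) (inducedClassifier fstar z.1) z.2) D :=
    integrable_of_abs_le hφ fun z => hB (h z.1, inducedClassifier fstar z.1, z.2)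
  refine ⟨?_, ?_⟩
  · rw [← integral_of_realizes hfs hφi]
    have hA : MeasurableSet {z : X × Bool | h z.1 ≠ some z.2 ∧ h z.1 ≠ none} :=
      measurableSet_pred hh fun o b => o ≠ some b ∧ o ≠ none
    have hN : MeasurableSet {z : X × Bool | h z.1 = none} := measurable_fst (hh none)
    have hE : MeasurableSet {z : X × Bool | inducedClassifier fstar z.1 ≠ z.2} :=
      (measurableSet_eq_fun (hind.comp measurable_fst) measurable_snd).compl
    have hi : ∀ {S : Set (X × Bool)}, MeasurableSet S →
        Integrable (S.indicator (1 : X × Bool → ℝ)) D :=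
      fun hS => (integrable_const (1 : ℝ)).indicator hS
    have hAN : Integrable (fun z =>
        {z : X × Bool | h z.1 ≠ some z.2 ∧ h z.1 ≠ none}.indicator (1 : X × Bool → ℝ) z +
          (1 / 2 - γ) * {z : X × Bool | h z.1 = none}.indicator (1 : X × Bool → ℝ) z) D :=
      (hi hA).add ((hi hN).const_mul _)
    rw [chowExcess, chowErr, err, ← integral_indicator_one hA, ← integral_indicator_one hN,
      ← integral_indicator_one hE, ← integral_const_mul,
      ← integral_add (hi hA) ((hi hN).const_mul _), ← integral_sub hAN (hi hE)]
    refine integral_congr_ae (ae_of_all _ fun z => ?_)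
    simp [predLoss, Set.indicator_apply]
  · exact integrable_of_realizes hfs hφi

/-- Integrate `predLoss_le` and split by `2 u ≤ a u² + 1 / a` on the query region. -/
lemma chowExcess_le {f : X → ℝ} (hF : ∀ f ∈ F, Measurable f ∧ ∀ x, f x ∈ Set.Icc (0 : ℝ) 1)
    (hG : G ⊆ F) (hf : f ∈ G) (hfG : fstar ∈ G) (hfs : Realizes D fstar)
    (hl : Measurable (lcb G)) (hu : Measurable (ucb G)) {a : ℝ} (ha : 0 < a) :
    chowExcess D γ fstar (epochClassifier G f γ) ≤
      a * sqDist D.fst f fstar {x | Queries G f γ x} +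
        D.fst.real {x | Queries G f γ x} / a := by
  have hF1 : ∀ f ∈ F, ∀ x, f x ∈ Set.Icc (0 : ℝ) 1 := fun f hf => (hF f hf).2
  obtain ⟨hfm, hf1⟩ := hF f (hG hf)
  obtain ⟨hsm, hs1⟩ := hF fstar (hG hfG)
  have hq : MeasurableSet {x | Queries G f γ x} := by
    simp only [queries_iff]
    exact ((measurableSet_lt hl measurable_const).inter
      (measurableSet_lt measurable_const hu)).inter
        ((measurableSet_le measurable_const hl).inter
          (measurableSet_le hu measurable_const)).compl
  obtain ⟨h1, h2⟩ := chowExcess_eq_integral (γ := γ) (D := D) (h := epochClassifier G f γ)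
    (measurableSet_epochClassifier_eq hfm hl hu
      fun x => (lcb_le hF1 hG hf).trans (le_ucb hF1 hG hf)) hsm hfs
  have hsq := integrable_indicator_sq (μ := D.fst) hfm hf1 hsm hs1 hq
  have h1i : Integrable ({x | Queries G f γ x}.indicator (1 : X → ℝ)) D.fst :=
    (integrable_const (1 : ℝ)).indicator hq
  rw [h1, sqDist, ← integral_indicator_one hq, ← integral_const_mul, ← integral_div,
    ← integral_add (hsq.const_mul a) (h1i.div_const a)]
  refine integral_mono h2 ((hsq.const_mul a).add (h1i.div_const a)) fun x => ?_
  refine (predLoss_le hF1 hG hf hfG).trans ?_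
  by_cases hx : x ∈ {x | Queries G f γ x}
  · simp only [Set.indicator_of_mem hx, Pi.one_apply]
    rw [← sq_abs, ← sub_nonneg]
    have : a * |f x - fstar x| ^ 2 + 1 / a - 2 * |f x - fstar x| =
        (a * |f x - fstar x| - 1) ^ 2 / a := by
      field_simp
      ring
    rw [this]
    positivity
  · simp [Set.indicator_of_notMem hx]

end Excess

/-! ### The run of the algorithm on a good sample -/

lemma sum_Ioc_tau (v : ℕ → ℝ) {a b : ℕ} (hab : a ≤ b) :
    ∑ t ∈ Finset.Ioc (tau a) (tau b), v (epochOf t) =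
      ∑ m ∈ Finset.Ico a b, ((tau (m + 1) : ℝ) - tau m) * v m := by
  induction b, hab using Nat.le_induction with
  | base => simp
  | succ b hab ih =>
    have hlt : tau b < tau (b + 1) := tau_strictMono (Nat.lt_succ_self b)
    rw [← Finset.sum_Ioc_consecutive _ (tau_strictMono.monotone hab) hlt.le, ih,
      Finset.sum_Ico_succ_top hab]
    congr 1
    rw [Finset.sum_congr rfl fun t ht => by
      rw [epochOf_eq (Finset.mem_Ioc.1 ht).1 (Finset.mem_Ioc.1 ht).2],
      Finset.sum_const, Nat.card_Ioc, nsmul_eq_mul, Nat.cast_sub hlt.le]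

lemma sqLoss_sub_sqLoss {X : Type*} (F : Set (X → ℝ)) (oracle : List (X × Bool) → X → ℝ) (γ : ℝ)
    (M : ℕ) (C : ℝ) (f fstar : X → ℝ) (z : ℕ → X × Bool) (m : ℕ) :
    sqLoss f (queried F oracle γ M C z m) - sqLoss fstar (queried F oracle γ M C z m) =
      excessLoss F oracle γ M C fstar f z 0 (tau m) := by
  classical
  rw [sqLoss, sqLoss, sum_map_queried, sum_map_queried, ← Finset.sum_sub_distrib, excessLoss]
  refine Finset.sum_congr rfl fun t _ => ?_
  split_ifs
  · rfl
  · simp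

open scoped Classical in
lemma labelCount_eq_sum {X : Type*} {F : Set (X → ℝ)} {oracle : List (X × Bool) → X → ℝ} {γ : ℝ}
    {M : ℕ} {C : ℝ} (z : ℕ → X × Bool) :
    (labelCount F oracle γ M C z : ℝ) = ∑ t ∈ Finset.Ioc 0 (tau (M - 1)),
      (if (z t).1 ∈ region F oracle γ M C z (epochOf t) then 1 else 0 : ℝ) := by
  rw [← sum_map_queried z (fun _ => 1)]
  simp [labelCount]

lemma active_subset_class {X : Type*} {F : Set (X → ℝ)} {oracle : List (X × Bool) → X → ℝ} {γ : ℝ}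
    {M : ℕ} {C : ℝ} {z : ℕ → X × Bool} (m : ℕ) : active F oracle γ M C z m ⊆ F :=
  fun _ hf => hf.1

section Run

variable {X : Type*} [MeasurableSpace X] {D : Measure (X × Bool)}
  {F : Set (X → ℝ)} {oracle : List (X × Bool) → X → ℝ} {γ : ℝ} {M : ℕ} {C : ℝ} {fstar : X → ℝ}
  {z : ℕ → X × Bool}

variable (D F oracle γ M C fstar z) in
/-- On the sequence `z` the excess losses dominate the squared distances to `fstar`. -/
def GoodLoss : Prop :=
  ∀ f ∈ F, ∀ a ≤ tau (M - 1), ∀ b ≤ tau (M - 1),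
    sumSqDist F oracle γ M C fstar D.fst f z a b / 4 - C / 2 ≤
      excessLoss F oracle γ M C fstar f z a b

variable (F oracle γ M C fstar z) in
lemma sumSqDist_nonneg (μ : Measure X) (f : X → ℝ) (a b : ℕ) :
    0 ≤ sumSqDist F oracle γ M C fstar μ f z a b :=
  Finset.sum_nonneg fun _ _ => integral_nonneg fun x =>
    Set.indicator_nonneg (fun _ _ => sq_nonneg _) x

lemma tau_le_of_le {m : ℕ} (hm : m ≤ M - 1) : tau m ≤ tau (M - 1) := tau_strictMono.monotone hm

lemma GoodLoss.neg_le (h : GoodLoss D F oracle γ M C fstar z) {f : X → ℝ} (hf : f ∈ F) {a b : ℕ}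
    (ha : a ≤ tau (M - 1)) (hb : b ≤ tau (M - 1)) :
    -(C / 2) ≤ excessLoss F oracle γ M C fstar f z a b := by
  linarith [h f hf a ha b hb, sumSqDist_nonneg F oracle γ M C fstar z D.fst f a b]

lemma GoodLoss.sqLoss_fstar_le (h : GoodLoss D F oracle γ M C fstar z)
    (ho : IsRegressionOracle F oracle) {m : ℕ} (hm : m ≤ M - 1) :
    sqLoss fstar (queried F oracle γ M C z m) ≤
      sqLoss (minimizer F oracle γ M C z m) (queried F oracle γ M C z m) + C / 2 := by
  have h1 := h.neg_le (ho (queried F oracle γ M C z m)).1 (Nat.zero_le _) (tau_le_of_le hm)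
  have h2 := sqLoss_sub_sqLoss F oracle γ M C
    (oracle (queried F oracle γ M C z m)) fstar z m
  rw [minimizer]
  linarith

lemma beta_ge (hC : 0 ≤ C) {m : ℕ} (hm : m + 1 ≤ M) : C ≤ beta M C (m + 1) := by
  have : ((m + 1 : ℕ) : ℝ) ≤ M := by exact_mod_cast hm
  rw [beta]
  nlinarith

lemma GoodLoss.fstar_mem_active (h : GoodLoss D F oracle γ M C fstar z)
    (ho : IsRegressionOracle F oracle) (hfF : fstar ∈ F) (hC : 0 ≤ C) (hM : 1 ≤ M) {m : ℕ}
    (hm : m ≤ M - 1) : fstar ∈ active F oracle γ M C z m := by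
  refine ⟨hfF, (h.sqLoss_fstar_le ho hm).trans ?_⟩
  rw [minimizer]
  linarith [beta_ge (M := M) hC (by omega : m + 1 ≤ M)]

/-- Undoing one epoch raises the excess loss of `f` by at most `C / 2`, and `fstar` is within `C /
2` of the earlier minimum. The earlier threshold is larger by exactly `C`. -/
lemma GoodLoss.active_succ_subset (h : GoodLoss D F oracle γ M C fstar z)
    (ho : IsRegressionOracle F oracle) (hfF : fstar ∈ F) {m : ℕ}
    (hm : m + 1 ≤ M - 1) :
    active F oracle γ M C z (m + 1) ⊆ active F oracle γ M C z m := by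
  classical
  rintro f ⟨hf, hle⟩
  refine ⟨hf, ?_⟩
  have h1 := h.sqLoss_fstar_le ho (by omega : m ≤ M - 1)
  have h2 := (ho (queried F oracle γ M C z (m + 1))).2 fstar hfF
  have h3 := sqLoss_sub_sqLoss F oracle γ M C f fstar z m
  have h4 := sqLoss_sub_sqLoss F oracle γ M C f fstar z
    (m + 1)
  have h5 := h.neg_le hf (tau_le_of_le (by omega : m ≤ M - 1)) (tau_le_of_le hm)
  have hlt : tau m ≤ tau (m + 1) := tau_strictMono.monotone (Nat.le_succ m)
  have h6 : excessLoss F oracle γ M C fstar f z 0 (tau (m + 1)) =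
      excessLoss F oracle γ M C fstar f z 0 (tau m) +
        excessLoss F oracle γ M C fstar f z (tau m) (tau (m + 1)) :=
    (Finset.sum_Ioc_consecutive _ (Nat.zero_le _) hlt).symm
  have h7 : beta M C (m + 1) = beta M C (m + 1 + 1) + C := by
    rw [beta, beta]
    push_cast
    ring
  rw [minimizer] at h1
  linarith

lemma GoodLoss.active_subset (h : GoodLoss D F oracle γ M C fstar z)
    (ho : IsRegressionOracle F oracle) (hfF : fstar ∈ F) {k m : ℕ} (hkm : k ≤ m)
    (hm : m ≤ M - 1) : active F oracle γ M C z m ⊆ active F oracle γ M C z k := by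
  induction m, hkm using Nat.le_induction with
  | base => exact subset_rfl
  | succ m hkm ih => exact (h.active_succ_subset ho hfF hm).trans (ih (by omega))

lemma GoodLoss.region_subset (h : GoodLoss D F oracle γ M C fstar z)
    (ho : IsRegressionOracle F oracle) (hF1 : ∀ f ∈ F, ∀ x, f x ∈ Set.Icc (0 : ℝ) 1)
    (hfF : fstar ∈ F) (hC : 0 ≤ C) (hM : 1 ≤ M) {k m : ℕ} (hkm : k ≤ m)
    (hm : m ≤ M - 1) : region F oracle γ M C z m ⊆ region F oracle γ M C z k :=
  fun _ hx => Queries.mono hF1 (active_subset_class k) (h.active_subset ho hfF hkm hm)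
    ⟨fstar, h.fstar_mem_active ho hfF hC hM hm⟩ hx

variable [IsProbabilityMeasure D]

/-- The members of the active set are close to `fstar` on the query region. -/
lemma GoodLoss.sqDist_le (h : GoodLoss D F oracle γ M C fstar z)
    (ho : IsRegressionOracle F oracle) (hF : ∀ f ∈ F, Measurable f ∧ ∀ x, f x ∈ Set.Icc (0 : ℝ) 1)
    (hmeas : MeasurableBounds F oracle) (hfF : fstar ∈ F) (hC : 0 ≤ C) (hM : 1 ≤ M) {m : ℕ}
    (hm : m ≤ M - 1) {f : X → ℝ} (hf : f ∈ active F oracle γ M C z m) :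
    tau m * sqDist D.fst f fstar (region F oracle γ M C z m) ≤ 8 * (M - m) * C := by
  have : Nonempty X := (nonempty_of_isProbabilityMeasure D.fst)
  obtain ⟨hfF', hle⟩ := hf
  obtain ⟨hfm, hf1⟩ := hF f hfF'
  obtain ⟨hsm, hs1⟩ := hF fstar hfF
  have h1 := (ho (queried F oracle γ M C z m)).2 fstar hfF
  have h2 := sqLoss_sub_sqLoss F oracle γ M C f fstar z m
  have h3 := h f hfF' 0 (Nat.zero_le _) (tau m) (tau_le_of_le hm)
  -- The regions shrink, so each of the `tau m` earlier terms dominates the squared distance on the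
  -- present region.
  have h4 : tau m * sqDist D.fst f fstar (region F oracle γ M C z m) ≤
      sumSqDist F oracle γ M C fstar D.fst f z 0 (tau m) := by
    have hcard : (tau m : ℝ) = ((Finset.Ioc 0 (tau m)).card : ℝ) := by simp
    rw [hcard, ← nsmul_eq_mul, sumSqDist]
    refine Finset.card_nsmul_le_sum _ _ _ fun t ht => ?_
    obtain ⟨ht0, ht1⟩ := Finset.mem_Ioc.1 ht
    have hlt : epochOf t < m := tau_strictMono.lt_iff_lt.1 ((tau_epochOf_lt ht0).trans_le ht1)
    have hsub := h.region_subset ho (fun f hf => (hF f hf).2) hfF hC hM hlt.le hm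
    have hq : ∀ k ≤ M, MeasurableSet (region F oracle γ M C z k) := fun k hk =>
      measurable_prodMk_left (measurableSet_region hmeas hC hk)
    exact integral_mono (integrable_indicator_sq hfm hf1 hsm hs1 (hq m (by omega)))
      (integrable_indicator_sq hfm hf1 hsm hs1 (hq _ (by omega)))
      (Set.indicator_le_indicator_of_subset hsub fun _ => sq_nonneg _)
  have h5 : ((m + 1 : ℕ) : ℝ) ≤ M := by exact_mod_cast (by omega : m + 1 ≤ M)
  have h6 : beta M C (m + 1) = (M - m) * C := by
    rw [beta]
    push_cast
    ring
  push_cast at h5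
  -- The good event gives `4 (β + C / 2) = 4 (M - m) C + 2 C`, and `M - m ≥ 1`.
  nlinarith

lemma GoodLoss.measure_region_le (h : GoodLoss D F oracle γ M C fstar z)
    (ho : IsRegressionOracle F oracle) (hF : ∀ f ∈ F, Measurable f ∧ ∀ x, f x ∈ Set.Icc (0 : ℝ) 1)
    (hmeas : MeasurableBounds F oracle) (hfF : fstar ∈ F) (hC : 0 < C) (hM : 1 ≤ M) (hγ : 0 < γ)
    (hθ : theta F γ ≠ ⊤) {m : ℕ} (hm0 : 1 ≤ m) (hm : m ≤ M - 1) :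
    D.fst.real (region F oracle γ M C z m) ≤
      4 * (theta F γ).toReal * (8 * (M - m) * C / tau m) / γ ^ 2 := by
  have : Nonempty X := (nonempty_of_isProbabilityMeasure D.fst)
  have hq : MeasurableSet (region F oracle γ M C z m) :=
    measurable_prodMk_left (measurableSet_region hmeas hC.le (by omega))
  have hτ : (0 : ℝ) < tau m := by
    exact_mod_cast (tau_strictMono (by omega : 0 < m))
  have hMm : (0 : ℝ) < M - m := by
    have : (m : ℝ) < M := by exact_mod_cast (by omega : m < M)
    linarith
  refine measureReal_le_theta (G := active F oracle γ M C z m) hfF (active_subset_class m) hγ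
    hθ D.fst hq (by positivity)
    (fun f hf => ?_) fun x hx => ?_
  · rw [le_div_iff₀ hτ, mul_comm]
    exact h.sqDist_le ho hF hmeas hfF hC.le hM hm hf
  · exact Queries.exists_far ⟨fstar, h.fstar_mem_active ho hfF hC.le hM hm⟩ hx

lemma measurable_bounds_active (hmeas : MeasurableBounds F oracle) (hC : 0 ≤ C) {m : ℕ}
    (hm : m ≤ M) : Measurable (lcb (active F oracle γ M C z m)) ∧
      Measurable (ucb (active F oracle γ M C z m)) := by
  obtain ⟨h1, h2⟩ := hmeas (queried F oracle γ M C z m).length _ (beta_succ_nonneg hC hm)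
  have h3 : Measurable fun x : X => ((queried F oracle γ M C z m).get, x) := measurable_prodMk_left
  have h1' := h1.comp h3
  have h2' := h2.comp h3
  simp only [Function.comp_def, List.ofFn_get] at h1' h2'
  exact ⟨h1', h2'⟩

lemma GoodLoss.chowExcess_output_le (h : GoodLoss D F oracle γ M C fstar z)
    (ho : IsRegressionOracle F oracle) (hF : ∀ f ∈ F, Measurable f ∧ ∀ x, f x ∈ Set.Icc (0 : ℝ) 1)
    (hmeas : MeasurableBounds F oracle) (hfF : fstar ∈ F) (hfs : Realizes D fstar) (hC : 0 < C)
    (hM : 2 ≤ M) (hγ : 0 < γ) (hθ : theta F γ ≠ ⊤) :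
    chowExcess D γ fstar (output F oracle γ M C z) ≤
      32 * (theta F γ).toReal * C / (tau (M - 1) * γ) := by
  set θ := (theta F γ).toReal with hθr
  have hθ1 : 1 ≤ θ := by
    rw [hθr, ← ENNReal.ofReal_le_iff_le_toReal hθ, ENNReal.ofReal_one]
    exact one_le_theta hfF γ
  have hM' : M - 1 + 1 = M := by omega
  have hτ : (0 : ℝ) < tau (M - 1) := by
    exact_mod_cast (tau_strictMono (by omega : 0 < M - 1))
  have hmin : minimizer F oracle γ M C z (M - 1) ∈ active F oracle γ M C z (M - 1) := by
    refine ⟨(ho _).1, ?_⟩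
    rw [minimizer]
    linarith [beta_succ_nonneg hC.le (by omega : M - 1 ≤ M)]
  obtain ⟨hl, hu⟩ := measurable_bounds_active (γ := γ) (z := z) hmeas hC.le (by omega : M - 1 ≤ M)
  have e : output F oracle γ M C z = epochClassifier (active F oracle γ M C z (M - 1))
      (minimizer F oracle γ M C z (M - 1)) γ := by
    rw [output, active, minimizer, hM']
  have hcast : (M : ℝ) - (M - 1 : ℕ) = 1 := by
    rw [Nat.cast_sub (by omega)]
    push_cast
    ring
  set V := 8 * C / tau (M - 1) with hV
  have hV0 : 0 < V := by positivity
  have h1 : sqDist D.fst (minimizer F oracle γ M C z (M - 1)) fstar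
      (region F oracle γ M C z (M - 1)) ≤ V := by
    have := h.sqDist_le ho hF hmeas hfF hC.le (by omega) le_rfl hmin
    rw [hcast, mul_one] at this
    rwa [hV, le_div_iff₀ hτ, mul_comm]
  have h2 : D.fst.real (region F oracle γ M C z (M - 1)) ≤ 4 * θ * V / γ ^ 2 := by
    have := h.measure_region_le ho hF hmeas hfF hC (by omega) hγ hθ (by omega) le_rfl
    rwa [hcast, mul_one] at this
  rw [e]
  -- This `a` gives the terms `2 θ V / γ` and `2 V / γ`; the second is absorbed using `θ ≥ 1`.
  refine (chowExcess_le hF (active_subset_class _) hmin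
    (h.fstar_mem_active ho hfF hC.le (by omega) le_rfl) hfs hl hu
    (a := 2 * θ / γ) (by positivity)).trans ?_
  calc _ ≤ 2 * θ / γ * V + 4 * θ * V / γ ^ 2 / (2 * θ / γ) := by
        refine add_le_add (mul_le_mul_of_nonneg_left h1 (by positivity))
          (div_le_div_of_nonneg_right h2 (by positivity))
    _ = (2 * θ + 2) * (V / γ) := by
        field_simp
        ring
    _ ≤ 4 * θ * (V / γ) := by
        refine mul_le_mul_of_nonneg_right (by linarith) (by positivity)
    _ = _ := by
        rw [hV]
        field_simp
        ring

/-- After the first epoch, the length of an epoch equals the number of samples before it, so the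
factor `1 / tau m` in the mass cancels. Over the last `J` epochs `M - m ≤ J + 1`. -/
lemma GoodLoss.sum_measure_region_le (h : GoodLoss D F oracle γ M C fstar z)
    (ho : IsRegressionOracle F oracle) (hF : ∀ f ∈ F, Measurable f ∧ ∀ x, f x ∈ Set.Icc (0 : ℝ) 1)
    (hmeas : MeasurableBounds F oracle) (hfF : fstar ∈ F) (hC : 1 ≤ C)
    (hM : 1 ≤ M) (hγ : 0 < γ) (hγ1 : γ ≤ 1) (hθ : theta F γ ≠ ⊤) {J : ℕ} :
    ∑ t ∈ Finset.Ioc (tau (M - 1 - J)) (tau (M - 1)),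
        D.fst.real (region F oracle γ M C z (epochOf t)) ≤
      J * (32 * (theta F γ).toReal * (J + 1) * C / γ ^ 2) := by
  set θ := (theta F γ).toReal with hθr
  have hθ1 : 1 ≤ θ := by
    rw [hθr, ← ENNReal.ofReal_le_iff_le_toReal hθ, ENNReal.ofReal_one]
    exact one_le_theta hfF γ
  have hK0 : 0 ≤ 32 * θ * (J + 1) * C / γ ^ 2 := by positivity
  rw [sum_Ioc_tau (fun m => D.fst.real (region F oracle γ M C z m)) (Nat.sub_le _ _)]
  refine (Finset.sum_le_card_nsmul _ _ (32 * θ * (J + 1) * C / γ ^ 2) fun m hm => ?_).trans ?_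
  · obtain ⟨hm1, hm2⟩ := Finset.mem_Ico.1 hm
    have hJ : (M : ℝ) - m ≤ J + 1 := by
      have : (M : ℝ) ≤ m + (J + 1) := by exact_mod_cast (by omega : M ≤ m + (J + 1))
      linarith
    -- The first epoch has no data behind it; its two times are bounded trivially.
    rcases Nat.eq_zero_or_pos m with rfl | hm0
    · have h1 : D.fst.real (region F oracle γ M C z 0) ≤ 1 := measureReal_le_one
      have h2 : (1 : ℝ) ≤ θ * (J + 1) * C := by
        have hJ1 : (1 : ℝ) ≤ (J : ℝ) + 1 := by linarith [(Nat.cast_nonneg J : (0 : ℝ) ≤ J)]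
        exact one_le_mul_of_one_le_of_one_le (one_le_mul_of_one_le_of_one_le hθ1 hJ1) hC
      have h3 : γ ^ 2 ≤ 1 := pow_le_one₀ hγ.le hγ1
      rw [le_div_iff₀ (by positivity)]
      simp only [tau, zero_add, pow_one, Nat.cast_ofNat, Nat.cast_zero, sub_zero]
      nlinarith [mul_le_mul h1 h3 (by positivity) zero_le_one]
    · have h1 := h.measure_region_le ho hF hmeas hfF (by linarith) hM hγ hθ hm0
        (by omega : m ≤ M - 1)
      have hτ : (0 : ℝ) < tau m := by exact_mod_cast (tau_strictMono hm0)
      have h2 : (tau (m + 1) : ℝ) - tau m = tau m := by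
        obtain ⟨k, rfl⟩ := Nat.exists_eq_succ_of_ne_zero hm0.ne'
        simp only [tau]
        push_cast
        ring
      rw [h2]
      calc _ ≤ (tau m : ℝ) * (4 * θ * (8 * (M - m) * C / tau m) / γ ^ 2) :=
            mul_le_mul_of_nonneg_left h1 hτ.le
        _ = 32 * θ * (M - m) * C / γ ^ 2 := by
            field_simp
            ring
        _ ≤ _ := by gcongr
  · rw [Nat.card_Ico, nsmul_eq_mul]
    refine mul_le_mul_of_nonneg_right ?_ hK0
    exact_mod_cast (by omega : M - 1 - (M - 1 - J) ≤ J)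

open scoped Classical in
-- Epochs before the last `J` are charged one label per time, and the rest by their conditional
-- query probabilities.
lemma GoodLoss.labelCount_le (h : GoodLoss D F oracle γ M C fstar z)
    (ho : IsRegressionOracle F oracle) (hF : ∀ f ∈ F, Measurable f ∧ ∀ x, f x ∈ Set.Icc (0 : ℝ) 1)
    (hmeas : MeasurableBounds F oracle) (hfF : fstar ∈ F) (hC : 1 ≤ C)
    (hM : 1 ≤ M) (hγ : 0 < γ) (hγ1 : γ ≤ 1) (hθ : theta F γ ≠ ⊤) {J : ℕ}
    (hcount : ∑ t ∈ Finset.Ioc (tau (M - 1 - J)) (tau (M - 1)),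
        (if (z t).1 ∈ region F oracle γ M C z (epochOf t) then 1 else 0 : ℝ) ≤
      2 * (∑ t ∈ Finset.Ioc (tau (M - 1 - J)) (tau (M - 1)),
        D.fst.real (region F oracle γ M C z (epochOf t))) + C) :
    (labelCount F oracle γ M C z : ℝ) ≤
      tau (M - 1 - J) + 2 * (J * (32 * (theta F γ).toReal * (J + 1) * C / γ ^ 2)) + C := by
  have h1 := h.sum_measure_region_le ho hF hmeas hfF hC hM hγ hγ1 hθ (J := J)
  rw [labelCount_eq_sum, ← Finset.sum_Ioc_consecutive _ (Nat.zero_le _)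
    (tau_le_of_le (Nat.sub_le (M - 1) J))]
  have h2 : ∑ t ∈ Finset.Ioc 0 (tau (M - 1 - J)),
      (if (z t).1 ∈ region F oracle γ M C z (epochOf t) then 1 else 0 : ℝ) ≤ tau (M - 1 - J) := by
    refine (Finset.sum_le_card_nsmul _ _ 1 fun t _ => ?_).trans (by simp)
    split_ifs <;> norm_num
  linarith

end Run

/-! ### Choice of the constants -/

/-- `L` and `c` solve the two tail conditions after taking logarithms. Each polynomial in `n ≤ T`
costs a multiple of `log T`. The factor `50` is half of the constant `100` in `C`, as the slack must
be at most `C / 2`. -/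
lemma exists_net_parameters {n d : ℕ} {T δ : ℝ} (hd : 1 ≤ d) (hT : 2 ^ 20 ≤ T) (hn : (n : ℝ) ≤ T)
    (hδ0 : 0 < δ) (hδ1 : δ < 1) :
    ∃ (L : ℕ) (c : ℝ), (2 * (n : ℝ) ^ 2 + 1) ^ (2 * d) ≤ δ / 2 * 2 ^ L ∧
      (2 * (n : ℝ) ^ 2 + 1) ^ d * (n + 1) ^ 2 * Real.exp (-c) ≤ δ / 2 ∧
      3 * L + 2 * c + 4 ≤ 50 * d * Real.log (T / δ) := by
  have hT0 : (0 : ℝ) < T := by linarith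
  have hn0 : (0 : ℝ) ≤ n := n.cast_nonneg
  have hd1 : (1 : ℝ) ≤ d := by exact_mod_cast hd
  have hl2 := Real.log_two_gt_d9
  have hl2' := Real.log_two_lt_d9
  have hlT : 13 ≤ Real.log T := by
    have h := Real.log_le_log (by norm_num) hT
    rw [Real.log_pow] at h
    push_cast at h
    linarith
  have hlδ : 0 ≤ -Real.log δ := by linarith [Real.log_nonpos hδ0.le hδ1.le]
  have hℓ : Real.log (T / δ) = Real.log T + -Real.log δ := by
    rw [Real.log_div hT0.ne' hδ0.ne']
    ring
  have hl2δ : Real.log (2 / δ) = Real.log 2 + -Real.log δ := by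
    rw [Real.log_div two_ne_zero hδ0.ne']
    ring
  set ℓ := Real.log (T / δ) with hℓdef
  set B := Real.log (2 * (n : ℝ) ^ 2 + 1) with hB
  have hB1 : B ≤ 3 * Real.log T := by
    have h : Real.log (T ^ 3) = 3 * Real.log T := by
      rw [Real.log_pow]
      norm_num
    rw [← h]
    refine Real.log_le_log (by positivity) ?_
    have h1 : (n : ℝ) ^ 2 ≤ T ^ 2 := pow_le_pow_left₀ hn0 hn 2
    nlinarith [sq_nonneg T]
  have hB2 : Real.log ((n : ℝ) + 1) ≤ 2 * Real.log T := by
    have h : Real.log (T ^ 2) = 2 * Real.log T := by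
      rw [Real.log_pow]
      norm_num
    rw [← h]
    refine Real.log_le_log (by positivity) ?_
    nlinarith
  have hdB : d * B ≤ d * (3 * Real.log T) := mul_le_mul_of_nonneg_left hB1 (by linarith)
  have hdδ : -Real.log δ ≤ d * -Real.log δ := le_mul_of_one_le_left hlδ hd1
  have hdT : Real.log T ≤ d * Real.log T := le_mul_of_one_le_left (by linarith) hd1
  have hdℓ : (d : ℝ) * ℓ = d * Real.log T + d * -Real.log δ := by rw [hℓ]; ring
  have hB0 : 0 ≤ B := Real.log_nonneg (by nlinarith [sq_nonneg (n : ℝ)])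
  refine ⟨⌈(Real.log (2 / δ) + 2 * (d * B)) / Real.log 2⌉₊,
    Real.log (2 / δ) + d * B + 2 * Real.log (n + 1), ?_, ?_, ?_⟩
  · set L := ⌈(Real.log (2 / δ) + 2 * (d * B)) / Real.log 2⌉₊ with hL
    have h1 := Nat.le_ceil ((Real.log (2 / δ) + 2 * (d * B)) / Real.log 2)
    rw [← hL, div_le_iff₀ (by linarith)] at h1
    rw [← Real.log_le_log_iff (by positivity) (by positivity), Real.log_mul (by positivity)
      (by positivity), Real.log_pow, Real.log_pow, Real.log_div hδ0.ne' two_ne_zero]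
    push_cast
    rw [← hB]
    linarith
  · rw [← Real.log_le_log_iff (by positivity) (by positivity), Real.log_mul (by positivity)
      (by positivity), Real.log_mul (by positivity) (by positivity), Real.log_pow, Real.log_pow,
      Real.log_exp, Real.log_div hδ0.ne' two_ne_zero]
    push_cast
    rw [← hB]
    linarith
  · have h1 := (Nat.ceil_lt_add_one (a := (Real.log (2 / δ) + 2 * (d * B)) / Real.log 2)
      (div_nonneg (by nlinarith) (by linarith))).le
    have h2 : (Real.log (2 / δ) + 2 * (d * B)) / Real.log 2 ≤ 9 * (d * ℓ) := by
      rw [div_le_iff₀ (by linarith)]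
      have : 6 * (d * ℓ) + 1 ≤ 9 * (d * ℓ) * 0.69 := by nlinarith
      have : 9 * (d * ℓ) * 0.69 ≤ 9 * (d * ℓ) * Real.log 2 :=
        mul_le_mul_of_nonneg_left (by linarith) (by nlinarith)
      linarith
    linarith

lemma two_pow_ceil_logb {T : ℝ} (hT : 1 < T) :
    (2 : ℝ) ^ (⌈Real.logb 2 T⌉₊ - 1) ≤ T ∧ T ≤ 2 * 2 ^ (⌈Real.logb 2 T⌉₊ - 1) := by
  have hpos : 0 < Real.logb 2 T := Real.logb_pos (by norm_num) hT
  obtain ⟨k, hk⟩ := Nat.exists_eq_succ_of_ne_zero (Nat.ceil_pos.2 hpos).ne'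
  have h1 := Nat.le_ceil (Real.logb 2 T)
  have h2 := Nat.ceil_lt_add_one hpos.le
  rw [hk] at h1 h2 ⊢
  rw [Nat.succ_sub_one]
  push_cast at h1 h2
  constructor
  · rw [← Real.rpow_natCast, ← Real.le_logb_iff_rpow_le (by norm_num) (by linarith)]
    linarith
  · rw [← pow_succ', ← Real.rpow_natCast, ← Real.logb_le_iff_le_rpow (by norm_num) (by linarith)]
    push_cast
    linarith

lemma tau_sub_mul_le (k J : ℕ) : tau (k - J) * 2 ^ J ≤ tau k := by
  -- If `J ≥ k`, the truncated index is `0` and `tau 0 = 0`, consistent with having no earlier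
  -- epochs.
  rcases Nat.le_total k J with h | h
  · simp [Nat.sub_eq_zero_of_le h, tau]
  · obtain ⟨i, rfl⟩ := Nat.exists_eq_add_of_le' h
    rw [Nat.add_sub_cancel]
    cases i with
    | zero => simp [tau]
    | succ i =>
      rw [Nat.add_right_comm]
      simp only [tau]
      rw [← pow_add]
      exact Nat.pow_le_pow_right (by norm_num) (by omega)

lemma label_bound {θ d ε γ A Λ ℓ C : ℝ} {J a : ℕ} (hθ : 1 ≤ θ) (hd : 1 ≤ d) (hε : 0 < ε)
    (hγ : 0 < γ) (hγ1 : γ < 1 / 2) (hA : A = θ * d / (ε * γ)) (hA2 : Real.log 2 ≤ Real.log A)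
    (hΛ : Real.log 2 ≤ Λ) (hℓ : ℓ ≤ 23 * Λ) (hC : C = 100 * d * ℓ) (hC0 : 0 ≤ C)
    (hJ : (J : ℝ) * Real.log 2 ≤ Real.log A + Real.log 2)
    (ha : (a : ℝ) ≤ 2 ^ 20 * A * Λ * ε) :
    a + 2 * (J * (32 * θ * (J + 1) * C / γ ^ 2)) + C ≤
      10 ^ 7 * (θ * d / γ ^ 2) * Real.log A ^ 2 * Λ := by
  have hl2 := Real.log_two_gt_d9
  set l := Real.log A with hl
  set K := θ * d / γ ^ 2 with hK
  have hΛ0 : 0 < Λ := by linarith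
  have hK0 : 0 < K := by positivity
  have hl0 : 0 < l := by linarith
  have hJ3 : (J : ℝ) ≤ 3 * l := by
    have : (J : ℝ) * 0.69 ≤ J * Real.log 2 :=
      mul_le_mul_of_nonneg_left (by linarith) J.cast_nonneg
    linarith
  have hJ5 : (J : ℝ) + 1 ≤ 5 * l := by linarith
  have hl1 : 1 ≤ 2.2 * l ^ 2 := by nlinarith
  have hC' : C ≤ 2300 * d * Λ := by
    rw [hC]
    nlinarith
  have hγ2 : γ ^ 2 ≤ γ := by nlinarith
  have h1 : (a : ℝ) ≤ 2 ^ 20 * (K * Λ) := by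
    refine ha.trans ?_
    have e : 2 ^ 20 * A * Λ * ε = 2 ^ 20 * (θ * d / γ * Λ) := by
      rw [hA]
      field_simp
    rw [e]
    have : θ * d / γ ≤ K := by
      rw [hK]
      gcongr
    gcongr
  have hdK : d ≤ K := by
    rw [hK, le_div_iff₀ (by positivity)]
    nlinarith
  have h2 : C ≤ 2300 * (K * Λ) := by
    refine hC'.trans ?_
    nlinarith [mul_le_mul_of_nonneg_right hdK hΛ0.le]
  -- The only double logarithm: one factor of `log A` for the number of epochs, the other for the
  -- thresholds `β`.
  have h3 : (J : ℝ) * (32 * θ * (J + 1) * C / γ ^ 2) ≤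
      3 * l * (32 * θ * (5 * l) * (2300 * d * Λ) / γ ^ 2) := by
    gcongr
  have h4 : 3 * l * (32 * θ * (5 * l) * (2300 * d * Λ) / γ ^ 2) = 1104000 * (K * Λ) * l ^ 2 := by
    rw [hK]
    field_simp
    ring
  have hKΛ : 0 ≤ K * Λ := by positivity
  have h5 : K * Λ ≤ 2.2 * (K * Λ * l ^ 2) := by nlinarith
  have e : 10 ^ 7 * K * l ^ 2 * Λ = 10 ^ 7 * (K * Λ * l ^ 2) := by ring
  rw [e]
  have h6 : 0 ≤ K * Λ * l ^ 2 := by positivity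
  linarith

lemma excess_bound {θ d ε γ A Λ ℓ C T τ : ℝ} (hθ : 1 ≤ θ) (hd : 1 ≤ d) (hε : 0 < ε)
    (hγ : 0 < γ) (hA : A = θ * d / (ε * γ)) (hT : T = 2 ^ 20 * A * Λ) (hΛ : 0 < Λ)
    (hℓ : ℓ ≤ 23 * Λ) (hC : C = 100 * d * ℓ) (hτ : 0 < τ) (hTτ : T ≤ 2 * τ) :
    32 * θ * C / (τ * γ) ≤ ε := by
  rw [div_le_iff₀ (by positivity)]
  have e : ε * (T * γ) = 2 ^ 20 * (θ * d * Λ) := by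
    rw [hT, hA]
    field_simp
  have h1 : θ * d * ℓ ≤ θ * d * (23 * Λ) := mul_le_mul_of_nonneg_left hℓ (by positivity)
  have h2 : ε * (T * γ) ≤ ε * (2 * τ * γ) := by gcongr
  have h3 : 0 ≤ θ * d * Λ := by positivity
  rw [hC]
  -- The comparison is `32 * 100 * 23` against `2 ^ 19`, half of the constant in `T`.
  linarith

open scoped Classical in
/-- With high probability the excess losses dominate the squared distances, and the number of
labels queried in the last `J` epochs before the end is controlled by its conditional mean. -/
lemma exists_good_event {X Ω : Type*} [MeasurableSpace X] [MeasurableSpace Ω] {P : Measure Ω}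
    [IsProbabilityMeasure P] {D : Measure (X × Bool)} [IsProbabilityMeasure D]
    {Z : ℕ → Ω → X × Bool} {F : Set (X → ℝ)} {oracle : List (X × Bool) → X → ℝ} {γ : ℝ} {M : ℕ}
    {C : ℝ} {fstar : X → ℝ} (hZ : ∀ t, Measurable (Z t)) (hD : ∀ t, P.map (Z t) = D)
    (hind : iIndepFun Z P) (hmeas : MeasurableBounds F oracle) (hC : 0 ≤ C)
    (hF : ∀ f ∈ F, Measurable f ∧ ∀ x, f x ∈ Set.Icc (0 : ℝ) 1) (hsep : PointwiseSeparable F)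
    (hfF : fstar ∈ F) (hfs : Realizes D fstar) {d : ℕ} (hd : pdim F ≤ d) (hM : 2 ≤ M)
    {L : ℕ} {δ c : ℝ} (hδ0 : 0 < δ) (hδ : δ ≤ 1)
    (hL : (2 * (tau (M - 1) : ℝ) ^ 2 + 1) ^ (2 * d) ≤ δ / 2 * 2 ^ L)
    (hc : (2 * (tau (M - 1) : ℝ) ^ 2 + 1) ^ d * (tau (M - 1) + 1) ^ 2 * Real.exp (-c) ≤ δ / 2)
    (hLc : 3 * L + 2 * c + 4 ≤ C / 2) (hCδ : Real.exp (-C) ≤ δ) (J : ℕ) :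
    ∃ E : Set Ω, MeasurableSet E ∧ 1 - 2 * δ ≤ P.real E ∧
      ∀ ω ∈ E, GoodLoss D F oracle γ M C fstar (fun t => Z t ω) ∧
        ∑ t ∈ Finset.Ioc (tau (M - 1 - J)) (tau (M - 1)),
          (if (Z t ω).1 ∈ region F oracle γ M C (fun t => Z t ω) (epochOf t) then 1 else 0 : ℝ) ≤
        2 * (∑ t ∈ Finset.Ioc (tau (M - 1 - J)) (tau (M - 1)),
          D.fst.real (region F oracle γ M C (fun t => Z t ω) (epochOf t))) + C := by
  have hn0 : 0 < tau (M - 1) := tau_strictMono (by omega : 0 < M - 1)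
  have hnM : tau (M - 1) ≤ tau M := tau_strictMono.monotone (Nat.sub_le _ _)
  have hloss := measure_uniform_loss_le (γ := γ) hZ hD hind hmeas hC hF hsep
    hfF hfs hd hn0 hnM hδ0.le hδ hL hc
  have hcount := measure_count_le (γ := γ) hZ hD hind hmeas hC (tau (M - 1 - J)) hnM C
  set B₁ := {ω | ¬ ∀ f ∈ F, ∀ a ≤ tau (M - 1), ∀ b ≤ tau (M - 1),
      sumSqDist F oracle γ M C fstar D.fst f (fun s => Z s ω) a b / 4 - (3 * L + 2 * c + 4) ≤
        excessLoss F oracle γ M C fstar f (fun s => Z s ω) a b} with hB₁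
  set B₂ := {ω | 2 * (∑ t ∈ Finset.Ioc (tau (M - 1 - J)) (tau (M - 1)),
        D.fst.real (region F oracle γ M C (fun s => Z s ω) (epochOf t))) + C ≤
      ∑ t ∈ Finset.Ioc (tau (M - 1 - J)) (tau (M - 1)),
        (if (Z t ω).1 ∈ region F oracle γ M C (fun s => Z s ω) (epochOf t)
          then 1 else 0 : ℝ)} with hB₂
  have hbad : P (B₁ ∪ B₂) ≤ ENNReal.ofReal (2 * δ) := by
    refine (measure_union_le _ _).trans ((add_le_add hloss
      (hcount.trans (ENNReal.ofReal_le_ofReal hCδ))).trans_eq ?_)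
    rw [← ENNReal.ofReal_add hδ0.le hδ0.le, two_mul]
  -- The bad set quantifies over the whole class, so it is enlarged to a measurable set of the same
  -- measure.
  refine ⟨(toMeasurable P (B₁ ∪ B₂))ᶜ, (measurableSet_toMeasurable _ _).compl, ?_, fun ω hω => ?_⟩
  · rw [probReal_compl_eq_one_sub (measurableSet_toMeasurable _ _)]
    have : P.real (toMeasurable P (B₁ ∪ B₂)) ≤ 2 * δ := by
      rw [measureReal_def, measure_toMeasurable]
      exact ENNReal.toReal_le_of_le_ofReal (by linarith) hbad
    linarith
  have hω₁ : ω ∉ B₁ := fun h => hω (subset_toMeasurable P _ (Or.inl h))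
  have hω₂ : ω ∉ B₂ := fun h => hω (subset_toMeasurable P _ (Or.inr h))
  rw [hB₁, Set.mem_ofPred_eq, not_not] at hω₁
  rw [hB₂, Set.mem_ofPred_eq, not_le] at hω₂
  refine ⟨fun f hf a ha b hb => ?_, hω₂.le⟩
  have h1 := hω₁ f hf a ha b hb
  linarith

end AbstainAL

/-! ### Assembly of the theorem. -/

open AbstainAL in
theorem mainTheorem1 :
    ∃ cT cC cL : ℝ, 0 < cT ∧ 0 < cC ∧ 0 < cL ∧
      ∀ (X : Type*) [MeasurableSpace X] (F : Set (X → ℝ)) (oracle : List (X × Bool) → X → ℝ)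
        (D : Measure (X × Bool)) [IsProbabilityMeasure D] (fstar : X → ℝ)
        (Ω : Type*) [MeasurableSpace Ω] (P : Measure Ω) [IsProbabilityMeasure P]
        (Z : ℕ → Ω → X × Bool) (ε γ δ θ d A T C : ℝ) (M : ℕ),
        -- the regression functions are measurable and map into `[0, 1]`
        (∀ f ∈ F, Measurable f ∧ ∀ x, f x ∈ Set.Icc (0 : ℝ) 1) →
        AbstainAL.IsRegressionOracle F oracle →
        -- measurability of the class and of the confidence bounds in the sample and the input
        AbstainAL.PointwiseSeparable F →
        (∀ (n : ℕ) (r : ℝ), 0 ≤ r →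
          Measurable (fun p : (Fin n → X × Bool) × X =>
            AbstainAL.lcb (AbstainAL.activeSet F oracle (List.ofFn p.1) r) p.2) ∧
          Measurable (fun p : (Fin n → X × Bool) × X =>
            AbstainAL.ucb (AbstainAL.activeSet F oracle (List.ofFn p.1) r) p.2)) →
        -- the complexity measures are finite
        AbstainAL.pdim F ≠ ⊤ → 1 ≤ AbstainAL.pdim F → AbstainAL.theta F γ ≠ ⊤ →
        -- realizability
        fstar ∈ F → AbstainAL.Realizes D fstar →
        -- the examples are drawn independently from `D`
        (∀ t, Measurable (Z t)) → (∀ t, P.map (Z t) = D) → iIndepFun Z P →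
        0 < ε → ε ≤ 1 → 0 < γ → γ < 1 / 2 → 0 < δ → δ < 1 →
        -- the quantities that the algorithm computes from its input
        θ = (AbstainAL.theta F γ).toReal → d = ((AbstainAL.pdim F).toNat : ℝ) →
        A = θ * d / (ε * γ) →
        T = cT * A * Real.log (A / δ) →
        M = ⌈Real.logb 2 T⌉₊ →
        C = cC * d * Real.log (T / δ) →
        ∃ E : Set Ω, MeasurableSet E ∧ 1 - 2 * δ ≤ P.real E ∧
          ∀ ω ∈ E,
            AbstainAL.chowExcess D γ fstar
              (AbstainAL.output F oracle γ M C (fun t => Z t ω)) ≤ ε ∧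
            (AbstainAL.labelCount F oracle γ M C (fun t => Z t ω) : ℝ) ≤
              cL * (θ * d / γ ^ 2) * Real.log A ^ 2 * Real.log (A / δ) := by
  classical
  refine ⟨2 ^ 20, 100, 10 ^ 7, by norm_num, by norm_num, by norm_num, ?_⟩
  intro X _ F oracle D _ fstar Ω _ P _ Z ε γ δ θ d A T C M hF ho hsep hmeas hpd hpd1 hθ hfF hfs hZ
    hD hind hε hε1 hγ hγ1 hδ hδ1 hθd hdd hA hT hM hC
  have hθ1 : 1 ≤ θ := by
    rw [hθd, ← ENNReal.ofReal_le_iff_le_toReal hθ, ENNReal.ofReal_one]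
    exact one_le_theta hfF γ
  have hdn : ((pdim F).toNat : ℕ∞) = pdim F := ENat.natCast_toNat hpd
  have hdn1 : 1 ≤ (pdim F).toNat := by
    rw [← hdn] at hpd1
    exact_mod_cast hpd1
  have hd1 : 1 ≤ d := by
    rw [hdd]
    exact_mod_cast hdn1
  have hl2 := Real.log_two_gt_d9
  have hl2' := Real.log_two_lt_d9
  have hθdge : 1 ≤ θ * d := one_le_mul_of_one_le_of_one_le hθ1 hd1
  have hA1 : 2 ≤ A := by
    rw [hA, le_div_iff₀ (by positivity)]
    nlinarith
  have hAε : 1 / ε ≤ A := by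
    rw [hA, div_le_div_iff₀ hε (by positivity)]
    nlinarith
  have hA0 : 0 < A := by linarith
  have hlA : Real.log 2 ≤ Real.log A := Real.log_le_log (by norm_num) hA1
  have hlδ : 0 ≤ -Real.log δ := by linarith [Real.log_nonpos hδ.le hδ1.le]
  set Λ := Real.log (A / δ) with hΛ
  have hΛA : Λ = Real.log A + -Real.log δ := by
    rw [hΛ, Real.log_div hA0.ne' hδ.ne']
    ring
  have hΛ2 : Real.log 2 ≤ Λ := by linarith
  have hΛ0 : 0 < Λ := by linarith
  have hT20 : 2 ^ 20 ≤ T := by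
    rw [hT]
    have : 1 ≤ A * Λ := by nlinarith
    nlinarith
  have hT0 : 0 < T := by linarith
  set ℓ := Real.log (T / δ) with hℓ
  have hℓT : ℓ = 20 * Real.log 2 + Real.log Λ + Λ := by
    have e : T / δ = 2 ^ 20 * (Λ * (A / δ)) := by
      rw [hT]
      ring
    rw [hℓ, e, Real.log_mul (by positivity) (by positivity),
      Real.log_mul (by positivity) (by positivity), Real.log_pow]
    push_cast
    ring
  -- Here `log Λ ≤ Λ - 1` and `log 2 ≤ Λ`, so the logarithm of `T / δ` is comparable to that of `A /
  -- δ`.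
  have hℓ23 : ℓ ≤ 23 * Λ := by
    linarith [Real.log_le_sub_one_of_pos hΛ0]
  have hlT : 13 ≤ Real.log T := by
    have h := Real.log_le_log (by norm_num) hT20
    rw [Real.log_pow] at h
    push_cast at h
    linarith
  have hℓδ : ℓ = Real.log T + -Real.log δ := by
    rw [hℓ, Real.log_div hT0.ne' hδ.ne']
    ring
  have hCℓ : ℓ ≤ C := by
    rw [hC]
    nlinarith
  have hC1 : 1 ≤ C := by linarith
  have hM2 : 2 ≤ M := by
    have h1 : (20 : ℝ) ≤ Real.logb 2 T := by
      rw [Real.le_logb_iff_rpow_le (by norm_num) hT0]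
      exact_mod_cast hT20
    have h2 : (20 : ℝ) ≤ M := by
      rw [hM]
      exact h1.trans (Nat.le_ceil _)
    have : 20 ≤ M := by exact_mod_cast h2
    omega
  have hτ : (tau (M - 1) : ℝ) = 2 ^ (M - 1) := by
    obtain ⟨k, hk⟩ : ∃ k, M - 1 = k + 1 := ⟨M - 2, by omega⟩
    rw [hk]
    simp [tau]
  obtain ⟨hnT, hTn⟩ := two_pow_ceil_logb (T := T) (by linarith)
  rw [← hM, ← hτ] at hnT hTn
  have hn0' : (0 : ℝ) < tau (M - 1) := by rw [hτ]; positivity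
  obtain ⟨L, c, hL, hc, hLc⟩ := exists_net_parameters hdn1 hT20 hnT hδ hδ1
  have hLc' : 3 * L + 2 * c + 4 ≤ C / 2 := by
    rw [hC, hdd]
    linarith
  have hCδ : Real.exp (-C) ≤ δ := by
    rw [← Real.le_log_iff_exp_le hδ]
    linarith
  -- Going back `J` doublings leaves at most `ε T` times, while `J ≤ log₂ A + 1` does not involve
  -- `δ`.
  set J := ⌈Real.logb 2 (1 / ε)⌉₊ with hJ
  obtain ⟨E, hE, hPE, hgood⟩ := exists_good_event (γ := γ) hZ hD hind hmeas (by linarith : 0 ≤ C)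
    hF hsep hfF hfs hdn.ge hM2 hδ hδ1.le hL hc hLc' hCδ J
  have hε' : 1 ≤ 1 / ε := by
    rw [le_div_iff₀ hε]
    linarith
  have hJA : (J : ℝ) * Real.log 2 ≤ Real.log A + Real.log 2 := by
    have h1 := (Nat.ceil_lt_add_one (Real.logb_nonneg (b := 2) (by norm_num) hε')).le
    rw [← hJ, Real.logb] at h1
    have h2 := mul_le_mul_of_nonneg_right h1 (by linarith : 0 ≤ Real.log 2)
    rw [add_mul, div_mul_cancel₀ _ (by linarith)] at h2
    linarith [Real.log_le_log (by positivity) hAε]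
  have hτJ : (tau (M - 1 - J) : ℝ) ≤ 2 ^ 20 * A * Λ * ε := by
    have h1 : (tau (M - 1 - J) : ℝ) * 2 ^ J ≤ tau (M - 1) := by
      exact_mod_cast tau_sub_mul_le (M - 1) J
    have h2 : 1 / ε ≤ 2 ^ J := by
      rw [← Real.rpow_natCast, ← Real.logb_le_iff_le_rpow (by norm_num) (by positivity)]
      exact Nat.le_ceil _
    have h3 : (tau (M - 1 - J) : ℝ) * (1 / ε) ≤ T :=
      (mul_le_mul_of_nonneg_left h2 (Nat.cast_nonneg _)).trans (h1.trans hnT)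
    rw [mul_one_div, div_le_iff₀ hε] at h3
    rw [← hT]
    exact h3
  refine ⟨E, hE, hPE, fun ω hω => ⟨?_, ?_⟩⟩
  · have h1 := (hgood ω hω).1.chowExcess_output_le ho hF hmeas hfF hfs (by linarith) hM2 hγ hθ
    rw [← hθd] at h1
    exact h1.trans (excess_bound hθ1 hd1 hε hγ hA hT hΛ0 hℓ23 hC hn0' hTn)
  · have h1 := (hgood ω hω).1.labelCount_le ho hF hmeas hfF hC1 (by omega) hγ (by linarith) hθ
      (hgood ω hω).2
    rw [← hθd] at h1
    exact h1.trans (label_bound hθ1 hd1 hε hγ hγ1 hA hlA hΛ2 hℓ23 hC (by linarith) hJA hτJ)
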